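/- Let $X_1,\dots,X_n$ be i.i.d. random variables on a probability space $(\Omega,\mathcal F,\mathbb P)$ with values in a measurable space $(E,\mathcal E)$ and common distribution $\mu$. For $m\ge 0$ and $f:E^m\to\mathbb R$ let $$J_m(f)=\sum_{1\le i_1<\dots<i_m\le n} f(X_{i_1},\dots,X_{i_m}),$$ so that $J_0(c)=c$ for a constant $c$. A kernel of order $m$ is a measurable function $f:E^m\to\mathbb R$; it is symmetric if it is invariant under all permutations of its arguments. For $m\ge1$ it is degenerate if $f\in L^1(\mu^{\otimes m})$ and $\int_E f(x_1,x_2,\dots,x_m)\,d\mu(x_1)=0$ for $\mu^{\otimes (m-1)}$-a.a. $(x_2,\dots,x_m)$; for $m=0$ no condition is imposed. We use the following notation. (a) For $f:E^m\to\mathbb R$, $\tilde f(x_1,\dots,x_m)=\frac1{m!}\sum_{\sigma\in\mathbb S_m}f(x_{\sigma(1)},\dots,x_{\sigma(m)})$. (b) For a symmetric $f\in L^1(\mu^{\otimes m})$ and $0\le s\le m$, the Hoeffding kernel of order $s$ of $f$ is $$f_s(x_1,\dots,x_s)=\sum_{k=0}^s(-1)^{s-k}\sum_{1\le i_1<\dots<i_k\le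 s}g_k(x_{i_1},\dots,x_{i_k}),\qquad g_k(y_1,\dots,y_k)=\int_{E^{m-k}} f(y_1,\dots,y_k,x)\,d\mu^{\otimes(m-k)}(x).$$ (c) For $f:E^p\to\mathbb R$, $g:E^q\to\mathbb R$ and $0\le l\le r\le p\wedge q$, the contraction $f\star_r^l g:E^{p+q-r-l}\to\mathbb R$ is $$(f\star_r^l g)(y,u,v)=\int_{E^l}f(x,y,u)\,g(x,y,v)\,d\mu^{\otimes l}(x),\qquad y\in E^{r-l},\ u\in E^{p-r},\ v\in E^{q-r},$$ set equal to $0$ where the integral does not exist as a real number (for $l=0$ there is no integration). Integrals in (b) are treated in the same way. (d) With $\mathcal F_M=\sigma(X_j:j\in M)$ for $M\subseteq[n]=\{1,\dots,n\}$, a Hoeffding decomposition of a random variable $Y$ is an almost sure identity $Y=\sum_{M\subseteq[n]}Y_M$ in which every $Y_M$ is integrable and $\mathcal F_M$-measurable, and $\mathbb E[Y_M\mid\mathcal F_J]=0$ a.s. whenever $M\not\subseteq J$. **Proposition (product formula for degenerate, symmetric $U$-statistics).** Let $p,q\ge1$ be integers, let $\psi\in L^2(\mu^{\otimes p})$ and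 $\phi\in L^2(\mu^{\otimes q})$ be degenerate, symmetric kernels of orders $p$ and $q$, and let $n\ge p+q$. For $t\in\{0,1,\dots,2(p\wedge q)\}$ define $\chi_{p+q-t}:E^{p+q-t}\to\mathbb R$ by $$\chi_{p+q-t}=\sum_{r=\lceil t/2\rceil}^{t\wedge p\wedge q}\binom{n-p-q+t}{t-r}\binom{p+q-t}{p-r,\;q-r,\;2r-t}\bigl(\widetilde{\psi\star_r^{t-r}\phi}\bigr)_{p+q-t}.$$ Then each $\chi_{p+q-t}$ is a degenerate, symmetric kernel of order $p+q-t$, and $\mathbb P$-almost surely $$J_p(\psi)\,J_q(\phi)=\sum_{t=0}^{2(p\wedge q)}J_{p+q-t}(\chi_{p+q-t}).$$ This is the Hoeffding decomposition of $Y=J_p(\psi)J_q(\phi)$: its summands are $Y_M=\chi_{p+q-t}(X_j,\,j\in M)$ if $|M|=p+q-t$ with $0\le t\le 2(p\wedge q)$, and $Y_M=0$ for all other $M\subseteq[n]$. -/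

import Mathlib

namespace UStat

open MeasureTheory

/-- The sum of `f (x_{i_1}, …, x_{i_p})` over all `1 ≤ i_1 < … < i_p ≤ n`, that is, over all
`p`-subsets of the index set, each listed increasingly. For `p = 0` it is the constant `f`. -/
noncomputable def uSum {E : Type*} {n p : ℕ} (x : Fin n → E) (f : (Fin p → E) → ℝ) : ℝ :=
  ∑ J : {J : Finset (Fin n) // J.card = p}, f (fun i => x (J.1.orderEmbOfFin J.2 i))

/-- The `U`-statistic `J_p(f)` of order `p` based on the sample `X` with kernel `f`. -/
noncomputable def uStat {Ω E : Type*} {n p : ℕ} (X : Fin n → Ω → E) (f : (Fin p → E) → ℝ) :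
    Ω → ℝ :=
  fun ω => uSum (fun i => X i ω) f

/-- A kernel is symmetric if it is invariant under every permutation of its arguments. -/
def IsSymmetric {E : Type*} {m : ℕ} (f : (Fin m → E) → ℝ) : Prop :=
  ∀ (σ : Equiv.Perm (Fin m)) (x : Fin m → E), f (fun i => x (σ i)) = f x

/-- A kernel of order `m ≥ 1` is (completely) degenerate with respect to `μ` if it is integrable
and integrating out its first argument gives zero for almost every choice of the others.
There is no condition on a kernel of order `0` (a constant). -/
def IsDegenerate {E : Type*} [MeasurableSpace E] (μ : Measure E) :
    ∀ {m : ℕ}, ((Fin m → E) → ℝ) → Prop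
  | 0, _ => True
  | k + 1, f =>
      Integrable f (Measure.pi (fun _ : Fin (k + 1) => μ)) ∧
        ∀ᵐ x ∂(Measure.pi (fun _ : Fin k => μ)), ∫ y, f (Fin.cons y x) ∂μ = 0

/-- The canonical symmetrization of a function of `m` arguments. -/
noncomputable def symmetrize {E : Type*} {m : ℕ} (f : (Fin m → E) → ℝ) : (Fin m → E) → ℝ :=
  fun x => (1 / (m.factorial : ℝ)) * ∑ σ : Equiv.Perm (Fin m), f (fun i => x (σ i))

/-- The contraction `ψ ⋆_r^l φ`, a function of `m = p + q - r - l` arguments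
`z = (y_1, …, y_{r-l}, t_1, …, t_{p-r}, s_1, …, s_{q-r})`: the integral over `x ∈ E^l` of
`ψ (x, y, t) * φ (x, y, s)`, and zero where this product is not integrable in `x`. -/
noncomputable def contraction {E : Type*} [MeasurableSpace E] (μ : Measure E) {p q : ℕ}
    (ψ : (Fin p → E) → ℝ) (φ : (Fin q → E) → ℝ) (r l : ℕ)
    (hlr : l ≤ r) (hrp : r ≤ p) (hrq : r ≤ q) {m : ℕ} (hm : m + r + l = p + q) :
    (Fin m → E) → ℝ :=
  fun z => ∫ x : Fin l → E,
    ψ (fun i => if h : i.1 < l then x ⟨i.1, h⟩ else z ⟨i.1 - l, by omega⟩) *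
    φ (fun i =>
        if h : i.1 < l then x ⟨i.1, h⟩
        else if h' : i.1 < r then z ⟨i.1 - l, by omega⟩
        else z ⟨(r - l) + (p - r) + (i.1 - r), by omega⟩)
    ∂(Measure.pi (fun _ : Fin l => μ))

/-- `g_k (y_1, …, y_k) = ∫ f (y_1, …, y_k, x_1, …, x_{p-k}) dμ^{p-k}(x)`, for `0 ≤ k ≤ p`. -/
noncomputable def partialMean {E : Type*} [MeasurableSpace E] (μ : Measure E) {p : ℕ}
    (f : (Fin p → E) → ℝ) (k : ℕ) : (Fin k → E) → ℝ :=
  fun y => ∫ x : Fin (p - k) → E,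
    f (fun i => if h : i.1 < k then y ⟨i.1, h⟩ else x ⟨i.1 - k, by omega⟩)
    ∂(Measure.pi (fun _ : Fin (p - k) => μ))

/-- The Hoeffding kernel `f_s`, for `0 ≤ s ≤ p`, of a symmetric kernel `f` of order `p`:
`f_s (x_1, …, x_s) = ∑_{k=0}^s (-1)^{s-k} ∑_{i_1 < … < i_k ≤ s} g_k (x_{i_1}, …, x_{i_k})`. -/
noncomputable def hoeffdingKernel {E : Type*} [MeasurableSpace E] (μ : Measure E) {p : ℕ}
    (f : (Fin p → E) → ℝ) (s : ℕ) : (Fin s → E) → ℝ :=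
  fun x => ∑ k ∈ Finset.range (s + 1), (-1 : ℝ) ^ (s - k) * uSum x (partialMean μ f k)

/-- The kernel `χ_m` of order `m = p + q - t` in the product formula,
`∑_{r = ⌈t/2⌉}^{t ∧ p ∧ q} C(n-p-q+t, t-r) * C(p+q-t; p-r, q-r, 2r-t) * (sym (ψ ⋆_r^{t-r} φ))_m`;
here `⌈t/2⌉` is the integer quotient `(t + 1) / 2`. -/
noncomputable def productKernel {E : Type*} [MeasurableSpace E] (n : ℕ) (μ : Measure E)
    {p q : ℕ} (ψ : (Fin p → E) → ℝ) (φ : (Fin q → E) → ℝ) (t : ℕ) {m : ℕ}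
    (hm : m + t = p + q) : (Fin m → E) → ℝ :=
  fun x => ∑ r : {r : ℕ // r ∈ Finset.Icc ((t + 1) / 2) (min t (min p q))},
    ((n - p - q + t).choose (t - r.1) : ℝ) *
    (Nat.multinomial Finset.univ ![p - r.1, q - r.1, 2 * r.1 - t] : ℝ) *
    hoeffdingKernel μ
      (symmetrize (contraction μ ψ φ r.1 (t - r.1)
        (by have := Finset.mem_Icc.1 r.2; omega)
        (by have := Finset.mem_Icc.1 r.2; omega)
        (by have := Finset.mem_Icc.1 r.2; omega)
        (m := m) (by have := Finset.mem_Icc.1 r.2; omega))) m x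

/-- The σ-algebra generated by the sample points `X_j`, `j ∈ M`. -/
abbrev sampleSigma {Ω E : Type*} [MeasurableSpace E] {n : ℕ} (X : Fin n → Ω → E)
    (M : Finset (Fin n)) : MeasurableSpace Ω :=
  ⨆ j ∈ M, MeasurableSpace.comap (X j) inferInstance

/-- `Y = ∑_M U_M` is the Hoeffding decomposition of `Y` with respect to the sample `X`: each `U_M`
is integrable and measurable with respect to `F_M = σ(X_j, j ∈ M)`, and `E[U_M | F_J] = 0`
almost surely whenever `M` is not contained in `J`. -/
structure IsHoeffdingDecomposition {Ω E : Type*} [MeasurableSpace Ω] [MeasurableSpace E] {n : ℕ}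
    (P : Measure Ω) (X : Fin n → Ω → E) (Y : Ω → ℝ) (U : Finset (Fin n) → Ω → ℝ) : Prop where
  integrable : ∀ M, Integrable (U M) P
  measurable : ∀ M, Measurable[sampleSigma X M] (U M)
  condExp_eq_zero : ∀ M J, ¬ M ⊆ J → P[U M | sampleSigma X J] =ᵐ[P] 0
  eq_sum : Y =ᵐ[P] fun ω => ∑ M, U M ω

end UStat

/-! On the product space `Fin n → E`, averaging out the coordinates outside `L` gives operators
`condMean μ L`, which compose by intersecting index sets. Möbius inversion over subsets turns them
into components `hoeffdingPart μ M F` that sum to `F` and have mean zero given any `J` not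
containing `M`. It therefore suffices to compute these components for `F = J_p(ψ) J_q(φ)`, a sum
over pairs `(A, B)` of `ψ(x_A) φ(x_B)`.

If some `j` in the symmetric difference of `A` and `B` lies outside `M`, averaging over `x_j` kills
the product, by degeneracy. If some `j ∈ M` lies outside `A ∪ B`, the alternating sum cancels. Only
pairs with `A ∆ B ⊆ M ⊆ A ∪ B` survive (`IsCompatible`). Let `|M| = p + q - t` and `|A ∩ B| = r`.
The `t - r` points of `A ∪ B` outside `M` are then common to `A` and `B`, and averaging them out
gives `ψ ⋆_r^{t-r} φ` at a suitable ordering of `M` (`condMean_pairProduct`).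

Double counting pairs against orderings of `M` (`sum_compatible_pairs`) produces the symmetrization
and both coefficients: the binomial one chooses `(A ∩ B) \ M`, the multinomial one splits `M` into
`A \ B`, `B \ A` and `A ∩ B ∩ M`. For symmetric kernels the `M`-component is the Hoeffding kernel of
top order (`hoeffdingKernel_comp`). Independence carries everything to the sample, where `condMean`
becomes conditional expectation (`condExp_comp_sample`). Square integrability makes the products,
and hence the contractions, integrable. -/

namespace UStat

open MeasureTheory

set_option linter.unusedSectionVars false

/-! ### Conditional means and Möbius inversion on a product space. -/

section ProductSpace

variable {ι κ E : Type*} [Fintype ι] [Fintype κ] [MeasurableSpace E]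
  (μ : Measure E) [IsProbabilityMeasure μ]

theorem measurePreserving_comp_injective {e : κ → ι} (he : Function.Injective e) :
    MeasurePreserving (fun (x : ι → E) k => x (e k)) (Measure.pi fun _ => μ)
      (Measure.pi fun _ => μ) := by
  classical
  refine ⟨by fun_prop, ?_⟩
  symm
  refine Measure.pi_eq fun s hs => ?_
  rw [Measure.map_apply (by fun_prop) (MeasurableSet.univ_pi hs)]
  -- Intersecting over the fibre of `e` avoids an inverse: it gives `s k` at `e k`, and the whole
  -- space, of mass one, off the range.
  have h : (fun (x : ι → E) k => x (e k)) ⁻¹' (Set.univ.pi s) =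
      Set.univ.pi (fun i => ⋂ (k) (_ : e k = i), s k) := by
    ext x
    simp only [Set.mem_preimage, Set.mem_pi, Set.mem_univ, true_imp_iff, Set.mem_iInter]
    exact ⟨fun h i k hk => hk ▸ h k, fun h k => h (e k) k rfl⟩
  rw [h, Measure.pi_pi]
  have h2 : ∀ k, (⋂ (k') (_ : e k' = e k), s k') = s k := by
    intro k
    ext y
    simp only [Set.mem_iInter]
    exact ⟨fun h => h k rfl, fun h k' hk' => he hk' ▸ h⟩
  rw [← Finset.prod_subset (Finset.subset_univ (Finset.univ.image e)),
    Finset.prod_image fun a _ b _ h => he h]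
  · simp only [h2]
  · intro i _ hi
    have : (⋂ (k) (_ : e k = i), s k) = Set.univ := by
      ext y
      simp only [Set.mem_iInter, Set.mem_univ, iff_true]
      intro k hk
      exact absurd (Finset.mem_image.2 ⟨k, Finset.mem_univ _, hk⟩) hi
    rw [this, measure_univ]

theorem integral_comp_injective {e : κ → ι} (he : Function.Injective e) {g : (κ → E) → ℝ}
    (hg : Measurable g) :
    ∫ y : ι → E, g (fun k => y (e k)) ∂(Measure.pi fun _ => μ) =
      ∫ y, g y ∂(Measure.pi fun _ => μ) := by
  have hmp := measurePreserving_comp_injective μ he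
  conv_rhs => rw [← hmp.map_eq]
  rw [integral_map hmp.measurable.aemeasurable hg.aestronglyMeasurable]

theorem integral_comp_eval (j : ι) {g : E → ℝ} (hg : Measurable g) :
    ∫ y : ι → E, g (y j) ∂(Measure.pi fun _ => μ) = ∫ y, g y ∂μ := by
  have hmp := measurePreserving_eval (fun _ : ι => μ) j
  conv_rhs => rw [← hmp.map_eq]
  rw [integral_map hmp.measurable.aemeasurable hg.aestronglyMeasurable]

variable [DecidableEq ι]

theorem measurable_piecewise_prod (L : Finset ι) :
    Measurable fun z : (ι → E) × (ι → E) => L.piecewise z.1 z.2 := by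
  refine measurable_pi_lambda _ fun i => ?_
  by_cases h : i ∈ L
  · simp only [Finset.piecewise, h, if_true]; fun_prop
  · simp only [Finset.piecewise, h, if_false]; fun_prop

/-- Replacing the coordinates outside `L` by those of an independent copy does not change the law.
This gives access to Fubini for `condMean`. -/
theorem measurePreserving_piecewise (L : Finset ι) :
    MeasurePreserving (fun z : (ι → E) × (ι → E) => L.piecewise z.1 z.2)
      ((Measure.pi fun _ => μ).prod (Measure.pi fun _ => μ)) (Measure.pi fun _ => μ) := by
  refine ⟨measurable_piecewise_prod L, ?_⟩
  symm
  refine Measure.pi_eq fun s hs => ?_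
  rw [Measure.map_apply (measurable_piecewise_prod L) (MeasurableSet.univ_pi hs)]
  have h : (fun z : (ι → E) × (ι → E) => L.piecewise z.1 z.2) ⁻¹' (Set.univ.pi s) =
      (Set.univ.pi fun i => if i ∈ L then s i else Set.univ) ×ˢ
        (Set.univ.pi fun i => if i ∈ L then Set.univ else s i) := by
    ext z
    simp only [Set.mem_preimage, Set.mem_pi, Set.mem_univ, true_imp_iff, Set.mem_prod,
      ← forall_and]
    refine forall_congr' fun i => ?_
    by_cases h : i ∈ L <;> simp [h]
  rw [h, Measure.prod_prod, Measure.pi_pi, Measure.pi_pi, ← Finset.prod_mul_distrib]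
  refine Finset.prod_congr rfl fun i _ => ?_
  by_cases h : i ∈ L <;> simp [h]

/-- The conditional mean of `F` given the coordinates in `L`, under the product measure. -/
noncomputable def condMean (L : Finset ι) (F : (ι → E) → ℝ) : (ι → E) → ℝ :=
  fun x => ∫ y, F (L.piecewise x y) ∂(Measure.pi fun _ => μ)

variable {μ}

theorem condMean_univ (F : (ι → E) → ℝ) : condMean μ Finset.univ F = F := by
  funext x
  simp [condMean]

theorem measurable_condMean (L : Finset ι) {F : (ι → E) → ℝ} (hF : Measurable F) :
    Measurable (condMean μ L F) := by
  have : StronglyMeasurable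
      (Function.uncurry fun (x y : ι → E) => F (L.piecewise x y)) :=
    (hF.comp (measurable_piecewise_prod L)).stronglyMeasurable
  exact this.integral_prod_right.measurable

theorem integrable_comp_piecewise (L : Finset ι) {F : (ι → E) → ℝ}
    (hF : Integrable F (Measure.pi fun _ => μ)) :
    Integrable (fun z : (ι → E) × (ι → E) => F (L.piecewise z.1 z.2))
      ((Measure.pi fun _ => μ).prod (Measure.pi fun _ => μ)) :=
  (measurePreserving_piecewise μ L).integrable_comp_of_integrable hF

theorem integrable_condMean (L : Finset ι) {F : (ι → E) → ℝ}
    (hF : Integrable F (Measure.pi fun _ => μ)) :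
    Integrable (condMean μ L F) (Measure.pi fun _ => μ) :=
  (integrable_comp_piecewise L hF).integral_prod_left

theorem ae_integrable_piecewise (L : Finset ι) {F : (ι → E) → ℝ}
    (hF : Integrable F (Measure.pi fun _ => μ)) :
    ∀ᵐ x ∂(Measure.pi fun _ => μ),
      Integrable (fun y => F (L.piecewise x y)) (Measure.pi fun _ => μ) :=
  (integrable_comp_piecewise L hF).prod_right_ae

theorem condMean_congr (L : Finset ι) {F G : (ι → E) → ℝ}
    (h : F =ᵐ[Measure.pi fun _ => μ] G) :
    condMean μ L F =ᵐ[Measure.pi fun _ => μ] condMean μ L G := by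
  have h1 := (measurePreserving_piecewise μ L).quasiMeasurePreserving.ae h
  filter_upwards [Measure.ae_ae_of_ae_prod h1] with x hx
  exact integral_congr_ae hx

theorem condMean_zero (L : Finset ι) : condMean μ L (fun _ : ι → E => 0) = fun _ => 0 := by
  funext x
  simp [condMean]

theorem condMean_sum {α : Type*} (s : Finset α) (L : Finset ι) (c : α → ℝ)
    {F : α → (ι → E) → ℝ} (hF : ∀ a ∈ s, Integrable (F a) (Measure.pi fun _ => μ)) :
    condMean μ L (fun x => ∑ a ∈ s, c a * F a x) =ᵐ[Measure.pi fun _ => μ]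
      fun x => ∑ a ∈ s, c a * condMean μ L (F a) x := by
  have h : ∀ᵐ x ∂(Measure.pi fun _ => μ), ∀ a ∈ s,
      Integrable (fun y => F a (L.piecewise x y)) (Measure.pi fun _ => μ) :=
    (Finset.eventually_all s).2 fun a ha => ae_integrable_piecewise L (hF a ha)
  filter_upwards [h] with x hx
  simp only [condMean]
  rw [integral_finsetSum s fun a ha => (hx a ha).const_mul (c a)]
  simp only [integral_const_mul]

/-- After both resamplings only the coordinates in `K ∩ L` are original, and the two fresh copies
merge into one by `measurePreserving_piecewise`. Fubini needs an integrable section, hence the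
almost everywhere statement. -/
theorem condMean_condMean (K L : Finset ι) {F : (ι → E) → ℝ}
    (hF : Integrable F (Measure.pi fun _ => μ)) :
    condMean μ K (condMean μ L F) =ᵐ[Measure.pi fun _ => μ] condMean μ (K ∩ L) F := by
  filter_upwards [ae_integrable_piecewise (K ∩ L) hF] with x hx
  have hpw : ∀ y z : ι → E, L.piecewise (K.piecewise x y) z =
      (K ∩ L).piecewise x (L.piecewise y z) := by
    intro y z
    ext i
    by_cases h : i ∈ L <;> by_cases h' : i ∈ K <;> simp [Finset.piecewise, h, h']
  simp only [condMean, hpw]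
  have hmp := measurePreserving_piecewise μ L
  rw [← integral_prod (fun z : (ι → E) × (ι → E) =>
    F ((K ∩ L).piecewise x (L.piecewise z.1 z.2))) (hmp.integrable_comp_of_integrable hx)]
  conv_rhs => rw [← hmp.map_eq]
  rw [integral_map hmp.measurable.aemeasurable (hmp.map_eq.symm ▸ hx.aestronglyMeasurable)]

theorem condMean_ae_zero_of_subset {K L : Finset ι} (hKL : K ⊆ L) {F : (ι → E) → ℝ}
    (hF : Integrable F (Measure.pi fun _ => μ))
    (h : condMean μ L F =ᵐ[Measure.pi fun _ => μ] fun _ => 0) :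
    condMean μ K F =ᵐ[Measure.pi fun _ => μ] fun _ => 0 := by
  have h1 := condMean_condMean K L hF
  rw [Finset.inter_eq_left.2 hKL] at h1
  have h2 := condMean_congr K h
  rw [condMean_zero] at h2
  exact h1.symm.trans h2

variable (μ) in
/-- The component of `F` indexed by `M` in the Hoeffding decomposition on the product space. -/
noncomputable def hoeffdingPart (M : Finset ι) (F : (ι → E) → ℝ) : (ι → E) → ℝ :=
  fun x => ∑ L ∈ M.powerset, (-1 : ℝ) ^ (M.card - L.card) * condMean μ L F x

/-- The terms of `L` and `insert j L` carry opposite signs and cancel in pairs. -/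
theorem alternating_sum_powerset_eq_zero {M : Finset ι} {j : ι} (hj : j ∈ M)
    {g : Finset ι → ℝ} (hg : ∀ L, g (insert j L) = g L) :
    ∑ L ∈ M.powerset, (-1 : ℝ) ^ (M.card - L.card) * g L = 0 := by
  obtain ⟨N, hjN, rfl⟩ : ∃ N, j ∉ N ∧ insert j N = M :=
    ⟨M.erase j, Finset.notMem_erase j M, Finset.insert_erase hj⟩
  rw [Finset.sum_powerset_insert hjN, ← Finset.sum_add_distrib]
  refine Finset.sum_eq_zero fun L hL => ?_
  have hLN := Finset.mem_powerset.1 hL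
  have hcard := Finset.card_le_card hLN
  rw [hg, Finset.card_insert_of_notMem hjN, Finset.card_insert_of_notMem fun h => hjN (hLN h),
    Nat.add_sub_add_right, Nat.sub_add_comm hcard, pow_succ]
  ring

/-- After exchanging sums, `condMean μ L F` has coefficient `∑ (-1)^|K|` over `K ⊆ Lᶜ`, with `K = M
\ L`. It vanishes unless `L` is everything. No integrability enters. -/
theorem sum_hoeffdingPart (F : (ι → E) → ℝ) (x : ι → E) :
    ∑ M, hoeffdingPart μ M F x = F x := by
  simp only [hoeffdingPart]
  rw [Finset.sum_comm' (t' := Finset.univ) (s' := fun L => Finset.univ.filter fun M => L ⊆ M)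
    (by simp)]
  rw [Finset.sum_eq_single Finset.univ]
  · have : (Finset.univ.filter fun M : Finset ι => Finset.univ ⊆ M) = {Finset.univ} := by
      ext M; simp [Finset.univ_subset_iff]
    rw [this]
    simp [condMean_univ]
  · intro L _ hL
    rw [← Finset.sum_mul]
    have h : ∑ M ∈ Finset.univ.filter (fun M => L ⊆ M), (-1 : ℝ) ^ (M.card - L.card) =
        ∑ K ∈ Lᶜ.powerset, (-1 : ℝ) ^ K.card := by
      refine Finset.sum_bij' (fun M _ => M \ L) (fun K _ => K ∪ L) ?_ ?_ ?_ ?_ ?_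
      · intro M _
        rw [Finset.mem_powerset]
        intro i hi
        simpa using (Finset.mem_sdiff.1 hi).2
      · intro K _
        simp
      · intro M hM
        exact Finset.sdiff_union_of_subset (Finset.mem_filter.1 hM).2
      · intro K hK
        rw [Finset.union_sdiff_right]
        refine Finset.sdiff_eq_self_of_disjoint ?_
        rw [Finset.mem_powerset, ← le_compl_iff_disjoint_right.symm.eq] at hK
        exact hK
      · intro M hM
        rw [Finset.card_sdiff_of_subset (Finset.mem_filter.1 hM).2]
    have h0 : ∑ K ∈ Lᶜ.powerset, (-1 : ℝ) ^ K.card = 0 := by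
      have := Finset.sum_powerset_neg_one_pow_card_of_nonempty (x := Lᶜ) (by
        rwa [Finset.nonempty_iff_ne_empty, Ne, Finset.compl_eq_empty_iff])
      exact_mod_cast congrArg (Int.cast : ℤ → ℝ) this
    rw [h, h0, zero_mul]
  · simp

theorem measurable_hoeffdingPart (M : Finset ι) {F : (ι → E) → ℝ} (hF : Measurable F) :
    Measurable (hoeffdingPart μ M F) :=
  Finset.measurable_fun_sum _ fun L _ => (measurable_condMean L hF).const_mul _

theorem integrable_hoeffdingPart (M : Finset ι) {F : (ι → E) → ℝ}
    (hF : Integrable F (Measure.pi fun _ => μ)) :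
    Integrable (hoeffdingPart μ M F) (Measure.pi fun _ => μ) :=
  integrable_finsetSum _ fun L _ => (integrable_condMean L hF).const_mul _

theorem ae_hoeffdingPart_of_condMean (M : Finset ι) {F G : (ι → E) → ℝ}
    (h : ∀ L ⊆ M, condMean μ L F =ᵐ[Measure.pi fun _ => μ] condMean μ L G) :
    hoeffdingPart μ M F =ᵐ[Measure.pi fun _ => μ] hoeffdingPart μ M G := by
  have h1 : ∀ᵐ x ∂(Measure.pi fun _ => μ), ∀ L ∈ M.powerset,
      condMean μ L F x = condMean μ L G x :=
    (Finset.eventually_all _).2 fun L hL => h L (Finset.mem_powerset.1 hL)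
  filter_upwards [h1] with x hx
  exact Finset.sum_congr rfl fun L hL => by rw [hx L hL]

theorem hoeffdingPart_zero (M : Finset ι) :
    hoeffdingPart μ M (fun _ : ι → E => 0) = fun _ => 0 := by
  funext x
  simp [hoeffdingPart, condMean_zero]

theorem hoeffdingPart_sum {α : Type*} (s : Finset α) (M : Finset ι) (c : α → ℝ)
    {F : α → (ι → E) → ℝ} (hF : ∀ a ∈ s, Integrable (F a) (Measure.pi fun _ => μ)) :
    hoeffdingPart μ M (fun x => ∑ a ∈ s, c a * F a x) =ᵐ[Measure.pi fun _ => μ]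
      fun x => ∑ a ∈ s, c a * hoeffdingPart μ M (F a) x := by
  have h1 : ∀ᵐ x ∂(Measure.pi fun _ => μ), ∀ L ∈ M.powerset,
      condMean μ L (fun x => ∑ a ∈ s, c a * F a x) x =
        ∑ a ∈ s, c a * condMean μ L (F a) x :=
    (Finset.eventually_all _).2 fun L _ => condMean_sum s L c hF
  filter_upwards [h1] with x hx
  simp only [hoeffdingPart, Finset.mul_sum]
  rw [Finset.sum_comm]
  refine Finset.sum_congr rfl fun L hL => ?_
  rw [hx L hL, Finset.mul_sum]
  exact Finset.sum_congr rfl fun a _ => by ring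

theorem hoeffdingPart_const_mul (M : Finset ι) (c : ℝ) (F : (ι → E) → ℝ) (x : ι → E) :
    hoeffdingPart μ M (fun x => c * F x) x = c * hoeffdingPart μ M F x := by
  simp only [hoeffdingPart, condMean, integral_const_mul, Finset.mul_sum]
  exact Finset.sum_congr rfl fun L _ => by ring

/-- Only means given subsets of `M` occur in the component, and these factor through the mean given
`M`. This is what allows a product to be replaced by its contraction. -/
theorem hoeffdingPart_condMean (M : Finset ι) {F : (ι → E) → ℝ}
    (hF : Integrable F (Measure.pi fun _ => μ)) :
    hoeffdingPart μ M (condMean μ M F) =ᵐ[Measure.pi fun _ => μ] hoeffdingPart μ M F := by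
  refine ae_hoeffdingPart_of_condMean M fun L hL => ?_
  simpa only [Finset.inter_eq_left.2 hL] using condMean_condMean L M hF

/-- For `j ∈ M \ J`, the set `J ∩ L` is unchanged when `j` joins `L`, so the alternating sum
cancels. -/
theorem condMean_hoeffdingPart {M J : Finset ι} (hMJ : ¬ M ⊆ J) {F : (ι → E) → ℝ}
    (hF : Integrable F (Measure.pi fun _ => μ)) :
    condMean μ J (hoeffdingPart μ M F) =ᵐ[Measure.pi fun _ => μ] fun _ => 0 := by
  obtain ⟨j, hjM, hjJ⟩ := Finset.not_subset.1 hMJ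
  have h1 : ∀ᵐ x ∂(Measure.pi fun _ => μ), ∀ L ∈ M.powerset,
      condMean μ J (condMean μ L F) x = condMean μ (J ∩ L) F x :=
    (Finset.eventually_all _).2 fun L _ => condMean_condMean J L hF
  have h2 := condMean_sum (μ := μ) M.powerset J (fun L => (-1 : ℝ) ^ (M.card - L.card))
    (F := fun L => condMean μ L F) fun L _ => integrable_condMean L hF
  filter_upwards [h1, h2] with x hx1 hx2
  rw [show condMean μ J (hoeffdingPart μ M F) x = _ from hx2]
  rw [Finset.sum_congr rfl fun L hL => by rw [hx1 L hL]]
  refine alternating_sum_powerset_eq_zero (g := fun L => condMean μ (J ∩ L) F x) hjM fun L => ?_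
  rw [Finset.inter_insert_of_notMem hjJ]

theorem hoeffdingPart_eq_zero_of_not_depends {M : Finset ι} {j : ι} (hj : j ∈ M)
    {F : (ι → E) → ℝ} (hF : ∀ x y, (∀ i, i ≠ j → x i = y i) → F x = F y) (x : ι → E) :
    hoeffdingPart μ M F x = 0 := by
  refine alternating_sum_powerset_eq_zero (g := fun L => condMean μ L F x) hj fun L => ?_
  refine integral_congr_ae (Filter.Eventually.of_forall fun y => hF _ _ fun i hi => ?_)
  by_cases h : i ∈ L <;> simp [Finset.piecewise, h, hi]

theorem hoeffdingPart_ae_zero_of_condMean {M L : Finset ι} (hML : M ⊆ L) {F : (ι → E) → ℝ}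
    (hF : Integrable F (Measure.pi fun _ => μ))
    (h : condMean μ L F =ᵐ[Measure.pi fun _ => μ] fun _ => 0) :
    hoeffdingPart μ M F =ᵐ[Measure.pi fun _ => μ] fun _ => 0 := by
  rw [← hoeffdingPart_zero (μ := μ) M]
  refine ae_hoeffdingPart_of_condMean M fun K hK => ?_
  rw [condMean_zero]
  exact condMean_ae_zero_of_subset (hK.trans hML) hF h

end ProductSpace

/-- Lifting `a` through `b` gives an injective self-map of `Fin m`, hence a permutation. Injectivity
of `a` and one inclusion of ranges therefore suffice. -/
theorem IsSymmetric.comp_eq {ι E : Type*} {m : ℕ} {h : (Fin m → E) → ℝ} (hh : IsSymmetric h)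
    {a b : Fin m → ι} (ha : Function.Injective a) (hab : ∀ i, ∃ j, b j = a i) (x : ι → E) :
    h (fun i => x (a i)) = h (fun i => x (b i)) := by
  choose s hs using hab
  have hinj : Function.Injective s := fun i j hij => ha (by rw [← hs, ← hs, hij])
  have := hh (Equiv.ofBijective s (Finite.injective_iff_bijective.1 hinj)) fun i => x (b i)
  simpa [hs] using this

/-! ### Index bookkeeping for the two factors of a contraction. -/

section Index

variable {α β : Type*} {p q r l m : ℕ}

/-- The first `p` entries of the sequence `c_1, …, c_l, d_1, …, d_m`. -/
def leftIndex (hp : p ≤ m + l) (c : Fin l → α) (d : Fin m → α) : Fin p → α :=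
  fun i => if h : i.1 < l then c ⟨i.1, h⟩ else d ⟨i.1 - l, by omega⟩

/-- The entries of `c_1, …, c_l, d_1, …, d_m` that a contraction feeds to its second factor. -/
def rightIndex (hlr : l ≤ r) (hrp : r ≤ p) (hrq : r ≤ q) (hm : m + r + l = p + q)
    (c : Fin l → α) (d : Fin m → α) : Fin q → α :=
  fun i => if h : i.1 < l then c ⟨i.1, h⟩
    else if h' : i.1 < r then d ⟨i.1 - l, by omega⟩
    else d ⟨(r - l) + (p - r) + (i.1 - r), by omega⟩

theorem comp_leftIndex (f : α → β) (hp : p ≤ m + l) (c : Fin l → α) (d : Fin m → α)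
    (i : Fin p) :
    f (leftIndex hp c d i) = leftIndex hp (fun j => f (c j)) (fun j => f (d j)) i := by
  unfold leftIndex
  split_ifs <;> rfl

theorem comp_rightIndex (f : α → β) (hlr : l ≤ r) (hrp : r ≤ p) (hrq : r ≤ q)
    (hm : m + r + l = p + q) (c : Fin l → α) (d : Fin m → α) (i : Fin q) :
    f (rightIndex hlr hrp hrq hm c d i) =
      rightIndex hlr hrp hrq hm (fun j => f (c j)) (fun j => f (d j)) i := by
  unfold rightIndex
  split_ifs <;> rfl

theorem leftIndex_injective (hp : p ≤ m + l) {c : Fin l → α} {d : Fin m → α}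
    (hc : Function.Injective c) (hd : Function.Injective d) (hcd : ∀ i j, c i ≠ d j) :
    Function.Injective (leftIndex hp c d) := by
  intro i j hij
  unfold leftIndex at hij
  ext
  split_ifs at hij with h1 h2 h2
  · simpa using hc hij
  · exact absurd hij (hcd _ _)
  · exact absurd hij.symm (hcd _ _)
  · have := hd hij
    simp only [Fin.mk.injEq] at this
    omega

theorem rightIndex_injective (hlr : l ≤ r) (hrp : r ≤ p) (hrq : r ≤ q)
    (hm : m + r + l = p + q) {c : Fin l → α} {d : Fin m → α}
    (hc : Function.Injective c) (hd : Function.Injective d) (hcd : ∀ i j, c i ≠ d j) :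
    Function.Injective (rightIndex hlr hrp hrq hm c d) := by
  intro i j hij
  unfold rightIndex at hij
  ext
  split_ifs at hij <;> first
    | exact absurd hij (hcd _ _)
    | exact absurd hij.symm (hcd _ _)
    | (have := hc hij; simp only [Fin.mk.injEq] at this; omega)
    | (have := hd hij; simp only [Fin.mk.injEq] at this; omega)

theorem measurable_leftIndex {E : Type*} [MeasurableSpace E] (hp : p ≤ m + l) :
    Measurable fun z : (Fin m → E) × (Fin l → E) => leftIndex hp z.2 z.1 := by
  refine measurable_pi_lambda _ fun i => ?_
  unfold leftIndex
  split_ifs <;> fun_prop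

theorem measurable_rightIndex {E : Type*} [MeasurableSpace E] (hlr : l ≤ r) (hrp : r ≤ p)
    (hrq : r ≤ q) (hm : m + r + l = p + q) :
    Measurable fun z : (Fin m → E) × (Fin l → E) => rightIndex hlr hrp hrq hm z.2 z.1 := by
  refine measurable_pi_lambda _ fun i => ?_
  unfold rightIndex
  split_ifs <;> fun_prop

end Index

theorem measurable_cons {E : Type*} [MeasurableSpace E] {k : ℕ} :
    Measurable fun z : (Fin k → E) × E => (Fin.cons z.2 z.1 : Fin (k + 1) → E) := by
  refine measurable_pi_lambda _ fun i => ?_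
  refine Fin.cases ?_ (fun i => ?_) i
  · simpa only [Fin.cons_zero] using measurable_snd
  · simp only [Fin.cons_succ]
    fun_prop

/-! ### Contractions as conditional means, and the effect of degeneracy. -/

section Contraction

variable {ι E : Type*} [Fintype ι] [DecidableEq ι] [MeasurableSpace E]
  {μ : Measure E} [IsProbabilityMeasure μ] {p q r l m : ℕ}

theorem measurable_contraction {ψ : (Fin p → E) → ℝ} {φ : (Fin q → E) → ℝ}
    (hψ : Measurable ψ) (hφ : Measurable φ)
    (hlr : l ≤ r) (hrp : r ≤ p) (hrq : r ≤ q) (hm : m + r + l = p + q) :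
    Measurable (contraction μ ψ φ r l hlr hrp hrq hm) := by
  have : StronglyMeasurable (Function.uncurry fun (z : Fin m → E) (x : Fin l → E) =>
      ψ (leftIndex (by omega) x z) * φ (rightIndex hlr hrp hrq hm x z)) :=
    ((hψ.comp (measurable_leftIndex _)).mul
      (hφ.comp (measurable_rightIndex hlr hrp hrq hm))).stronglyMeasurable
  exact this.integral_prod_right.measurable

/-- The positions `c` are averaged, the positions `d` are frozen, and the remaining coordinates
integrate to one. The identity holds at every point, since both integrals take the value zero where
the integrand is not integrable. -/
theorem condMean_mul_eq_contraction {ψ : (Fin p → E) → ℝ} {φ : (Fin q → E) → ℝ}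
    (hψ : Measurable ψ) (hφ : Measurable φ)
    (hlr : l ≤ r) (hrp : r ≤ p) (hrq : r ≤ q) (hm : m + r + l = p + q)
    {c : Fin l → ι} {d : Fin m → ι} (hc : Function.Injective c) {M : Finset ι}
    (hcM : ∀ i, c i ∉ M) (hdM : ∀ i, d i ∈ M) (x : ι → E) :
    condMean μ M (fun x => ψ (fun i => x (leftIndex (by omega) c d i)) *
      φ (fun i => x (rightIndex hlr hrp hrq hm c d i))) x =
      contraction μ ψ φ r l hlr hrp hrq hm (fun i => x (d i)) := by
  have hmeas : Measurable fun y : Fin l → E =>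
      ψ (leftIndex (by omega) y fun i => x (d i)) *
      φ (rightIndex hlr hrp hrq hm y fun i => x (d i)) :=
    ((hψ.comp (measurable_leftIndex _)).mul
      (hφ.comp (measurable_rightIndex hlr hrp hrq hm))).comp measurable_prodMk_left
  change _ = ∫ y : Fin l → E, ψ (leftIndex (by omega) y fun i => x (d i)) *
      φ (rightIndex hlr hrp hrq hm y fun i => x (d i)) ∂(Measure.pi fun _ => μ)
  rw [← integral_comp_injective μ hc hmeas]
  have hc' : ∀ (y : ι → E) j, M.piecewise x y (c j) = y (c j) := fun y j =>
    Finset.piecewise_eq_of_notMem _ _ _ (hcM j)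
  have hd' : ∀ (y : ι → E) j, M.piecewise x y (d j) = x (d j) := fun y j =>
    Finset.piecewise_eq_of_mem _ _ _ (hdM j)
  refine integral_congr_ae (Filter.Eventually.of_forall fun y => ?_)
  dsimp only
  congr 2 <;> funext i
  · rw [comp_leftIndex (M.piecewise x y)]
    simp only [hc', hd']
  · rw [comp_rightIndex (M.piecewise x y)]
    simp only [hc', hd']

theorem integrable_mul_comp {ψ : (Fin p → E) → ℝ} {φ : (Fin q → E) → ℝ}
    (hψ : MemLp ψ 2 (Measure.pi fun _ => μ)) (hφ : MemLp φ 2 (Measure.pi fun _ => μ))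
    {a : Fin p → ι} {b : Fin q → ι} (ha : Function.Injective a) (hb : Function.Injective b) :
    Integrable (fun x : ι → E => ψ (fun i => x (a i)) * φ (fun i => x (b i)))
      (Measure.pi fun _ => μ) :=
  MemLp.integrable_mul
    (hψ.comp_measurePreserving (measurePreserving_comp_injective μ ha))
    (hφ.comp_measurePreserving (measurePreserving_comp_injective μ hb))

/-- On the product over `Fin l ⊕ Fin m` the contraction is a conditional mean of a product of two
square-integrable functions, hence integrable. -/
theorem integrable_contraction {ψ : (Fin p → E) → ℝ} {φ : (Fin q → E) → ℝ}
    (hψ : Measurable ψ) (hφ : Measurable φ)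
    (hψ2 : MemLp ψ 2 (Measure.pi fun _ => μ)) (hφ2 : MemLp φ 2 (Measure.pi fun _ => μ))
    (hlr : l ≤ r) (hrp : r ≤ p) (hrq : r ≤ q) (hm : m + r + l = p + q) :
    Integrable (contraction μ ψ φ r l hlr hrp hrq hm) (Measure.pi fun _ => μ) := by
  have hinl : Function.Injective (Sum.inl : Fin l → Fin l ⊕ Fin m) := Sum.inl_injective
  have hinr : Function.Injective (Sum.inr : Fin m → Fin l ⊕ Fin m) := Sum.inr_injective
  have hne : ∀ (i : Fin l) (j : Fin m), (Sum.inl i : Fin l ⊕ Fin m) ≠ Sum.inr j := by simp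
  have h := integrable_condMean (Finset.univ.image (Sum.inr : Fin m → Fin l ⊕ Fin m))
    (integrable_mul_comp hψ2 hφ2 (leftIndex_injective (p := p) (by omega) hinl hinr hne)
      (rightIndex_injective hlr hrp hrq hm hinl hinr hne))
  have hcm := condMean_mul_eq_contraction (μ := μ) hψ hφ hlr hrp hrq hm hinl
    (M := Finset.univ.image (Sum.inr : Fin m → Fin l ⊕ Fin m)) (d := Sum.inr) (by simp) (by simp)
  rw [funext hcm] at h
  exact ((measurePreserving_comp_injective μ hinr).integrable_comp
    (measurable_contraction hψ hφ hlr hrp hrq hm).aestronglyMeasurable).1 h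

theorem isSymmetric_symmetrize (f : (Fin m → E) → ℝ) : IsSymmetric (symmetrize f) := by
  intro σ x
  simp only [symmetrize]
  congr 1
  exact Fintype.sum_equiv (Equiv.mulLeft σ) _ _ fun τ => rfl

theorem measurable_symmetrize {f : (Fin m → E) → ℝ} (hf : Measurable f) :
    Measurable (symmetrize f) := by
  unfold symmetrize
  fun_prop

theorem integrable_symmetrize {f : (Fin m → E) → ℝ}
    (hf : Integrable f (Measure.pi fun _ => μ)) :
    Integrable (symmetrize f) (Measure.pi fun _ => μ) :=
  (integrable_finsetSum _ fun σ _ => (measurePreserving_comp_injective μ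
    (Equiv.injective σ)).integrable_comp_of_integrable hf).const_mul _

theorem condMean_degenerate {ψ : (Fin p → E) → ℝ} (hψm : Measurable ψ) (hψ : IsDegenerate μ ψ)
    (hs : IsSymmetric ψ) {a : Fin p → ι} (ha : Function.Injective a) (i : Fin p) :
    condMean μ {a i}ᶜ (fun x => ψ fun k => x (a k)) =ᵐ[Measure.pi fun _ => μ] fun _ => 0 := by
  obtain _ | p := p
  · exact i.elim0
  -- Degeneracy concerns the first argument only; symmetry lets the swap bring argument `i` there.
  set b : Fin (p + 1) → ι := fun k => a (Equiv.swap 0 i k) with hb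
  have hbinj : Function.Injective b := ha.comp (Equiv.injective _)
  have hb0 : b 0 = a i := by simp [hb]
  have hψab : ∀ x : ι → E, ψ (fun k => x (a k)) = ψ (fun k => x (b k)) := fun x =>
    (hs (Equiv.swap 0 i) fun k => x (a k)).symm
  have hmp := measurePreserving_comp_injective μ (hbinj.comp (Fin.succ_injective p))
  filter_upwards [hmp.quasiMeasurePreserving.ae hψ.2] with x hx
  rw [← hx]
  refine Eq.trans ?_ (integral_comp_eval μ (a i)
    (hψm.comp (measurable_cons.comp measurable_prodMk_left)))
  simp only [condMean, hψab]
  refine integral_congr_ae (Filter.Eventually.of_forall fun y => congrArg ψ (funext fun k => ?_))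
  refine Fin.cases ?_ (fun k => ?_) k
  · simp [hb0]
  · have : b k.succ ≠ a i := by
      rw [← hb0]
      exact fun h => Fin.succ_ne_zero k (hbinj h)
    simp [Finset.piecewise, this]

theorem condMean_mul_degenerate {ψ : (Fin p → E) → ℝ} (hψm : Measurable ψ)
    (hψ : IsDegenerate μ ψ) (hs : IsSymmetric ψ) {a : Fin p → ι} (ha : Function.Injective a)
    (i : Fin p) (φ : (Fin q → E) → ℝ) {b : Fin q → ι} (hb : ∀ k, b k ≠ a i) :
    condMean μ {a i}ᶜ (fun x => ψ (fun k => x (a k)) * φ (fun k => x (b k)))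
      =ᵐ[Measure.pi fun _ => μ] fun _ => 0 := by
  filter_upwards [condMean_degenerate hψm hψ hs ha i] with x hx
  simp only [condMean] at hx ⊢
  have : ∀ y : ι → E, (fun k => ({a i}ᶜ : Finset ι).piecewise x y (b k)) = fun k => x (b k) := by
    intro y
    funext k
    simp [Finset.piecewise, hb k]
  simp only [this, integral_mul_const, hx, zero_mul]

end Contraction

/-! ### Hoeffding kernels of symmetric functions as components on the product space. -/

section HoeffdingKernel

variable {ι E : Type*} [Fintype ι] [DecidableEq ι] [MeasurableSpace E]
  {μ : Measure E} [IsProbabilityMeasure μ] {m : ℕ}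

theorem condMean_comp_eq_partialMean {h : (Fin m → E) → ℝ} (hm : Measurable h)
    (hs : IsSymmetric h) (e : Fin m ↪ ι) (J : Finset (Fin m)) (x : ι → E) :
    condMean μ (J.map e) (fun x => h fun i => x (e i)) x =
      partialMean μ h J.card fun i => x (e (J.orderEmbOfFin rfl i)) := by
  have hcard : Jᶜ.card = m - J.card := by simp [Finset.card_compl]
  have hJ : J.card ≤ m := by simpa using J.card_le_univ
  -- By symmetry the arguments may be listed with those of `J` first, the order used in
  -- `partialMean`.
  let u : Fin J.card → Fin m := fun i => J.orderEmbOfFin rfl i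
  let v : Fin (m - J.card) → Fin m := fun i => Jᶜ.orderEmbOfFin hcard i
  have huJ : ∀ i, u i ∈ J := fun i => J.orderEmbOfFin_mem rfl i
  have hvJ : ∀ i, v i ∉ J := fun i => Finset.mem_compl.1 (Jᶜ.orderEmbOfFin_mem hcard i)
  have huv : Function.Injective (leftIndex (p := m) (by omega) u v) :=
    leftIndex_injective _ (J.orderEmbOfFin rfl).injective (Jᶜ.orderEmbOfFin hcard).injective
      fun i j hij => hvJ j (hij ▸ huJ i)
  have hsurj := (Finite.injective_iff_bijective.1 huv).2
  have hh : ∀ w : ι → E, h (fun i => w (e i)) =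
      h (fun i => w (e (leftIndex (by omega) u v i))) := fun w =>
    hs.comp_eq e.injective (fun i => (hsurj i).imp fun j hj => by rw [hj]) w
  have hmeas : Measurable fun y : Fin (m - J.card) → E =>
      h (leftIndex (by omega) (fun i => x (e (u i))) y) := by
    refine hm.comp (measurable_pi_lambda _ fun i => ?_)
    unfold leftIndex
    split_ifs <;> fun_prop
  change _ = ∫ y : Fin (m - J.card) → E, h (leftIndex (by omega) (fun i => x (e (u i))) y)
      ∂(Measure.pi fun _ => μ)
  rw [← integral_comp_injective μ (e.injective.comp (Jᶜ.orderEmbOfFin hcard).injective) hmeas]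
  have hmem : ∀ i, e (u i) ∈ J.map e := fun i => Finset.mem_map_of_mem e (huJ i)
  have hnmem : ∀ i, e (v i) ∉ J.map e := fun i => by
    simpa using hvJ i
  simp only [condMean, hh]
  refine integral_congr_ae (Filter.Eventually.of_forall fun y => congrArg h (funext fun i => ?_))
  rw [comp_leftIndex e, comp_leftIndex ((J.map e).piecewise x y)]
  simp only [Finset.piecewise, hmem, hnmem, if_true, if_false]
  rfl

theorem hoeffdingKernel_eq_sum (f : (Fin m → E) → ℝ) (x : Fin m → E) :
    hoeffdingKernel μ f m x = ∑ J : Finset (Fin m), (-1 : ℝ) ^ (m - J.card) *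
      partialMean μ f J.card fun i => x (J.orderEmbOfFin rfl i) := by
  rw [← Finset.sum_fiberwise_of_maps_to (g := Finset.card) (t := Finset.range (m + 1))]
  · refine Finset.sum_congr rfl fun k _ => ?_
    rw [uSum, Finset.mul_sum]
    rw [← Finset.sum_subtype_eq_sum_filter]
    refine Finset.sum_bij' (fun J _ => ⟨J.1, J.2⟩) (fun J _ => ⟨J.1, J.2⟩) ?_ ?_ ?_ ?_ ?_ <;>
      simp
    rintro J rfl
    simp
  · intro J _
    have : J.card ≤ m := by simpa using J.card_le_univ
    simp; omega

/-- Subsets of the range of `e` are images of subsets of `Fin m`, so both alternating sums agree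
term by term. The ambient index set may be larger than the range of `e`. -/
theorem hoeffdingKernel_comp {h : (Fin m → E) → ℝ} (hm : Measurable h)
    (hs : IsSymmetric h) (e : Fin m ↪ ι) (x : ι → E) :
    hoeffdingKernel μ h m (fun i => x (e i)) =
      hoeffdingPart μ (Finset.univ.map e) (fun x => h fun i => x (e i)) x := by
  have hps : (Finset.univ.map e).powerset =
      Finset.univ.map (Finset.mapEmbedding e).toEmbedding := by
    ext L
    simp only [Finset.mem_powerset, Finset.mem_map, Finset.mem_univ, true_and,
      Finset.subset_map_iff, Finset.subset_univ]
    exact ⟨fun ⟨J, h⟩ => ⟨J, h.symm⟩, fun ⟨J, h⟩ => ⟨J, h.symm⟩⟩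
  rw [hoeffdingKernel_eq_sum, hoeffdingPart, hps, Finset.sum_map]
  refine Finset.sum_congr rfl fun J _ => ?_
  simp only [RelEmbedding.coe_toEmbedding, Finset.mapEmbedding_apply, Finset.card_map,
    Finset.card_univ, Fintype.card_fin]
  rw [condMean_comp_eq_partialMean hm hs]

theorem hoeffdingKernel_eq_hoeffdingPart {h : (Fin m → E) → ℝ} (hm : Measurable h)
    (hs : IsSymmetric h) : hoeffdingKernel μ h m = hoeffdingPart μ Finset.univ h := by
  funext x
  simpa using hoeffdingKernel_comp (μ := μ) hm hs (Function.Embedding.refl _) x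

theorem measurable_hoeffdingKernel {h : (Fin m → E) → ℝ} (hm : Measurable h)
    (hs : IsSymmetric h) : Measurable (hoeffdingKernel μ h m) := by
  rw [hoeffdingKernel_eq_hoeffdingPart hm hs]
  exact measurable_hoeffdingPart _ hm

theorem integrable_hoeffdingKernel {h : (Fin m → E) → ℝ} (hm : Measurable h)
    (hs : IsSymmetric h) (hi : Integrable h (Measure.pi fun _ => μ)) :
    Integrable (hoeffdingKernel μ h m) (Measure.pi fun _ => μ) := by
  rw [hoeffdingKernel_eq_hoeffdingPart hm hs]
  exact integrable_hoeffdingPart _ hi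

theorem isSymmetric_hoeffdingKernel {h : (Fin m → E) → ℝ} (hm : Measurable h)
    (hs : IsSymmetric h) : IsSymmetric (hoeffdingKernel μ h m) := by
  intro σ x
  have h1 := hoeffdingKernel_comp (μ := μ) hm hs σ.toEmbedding x
  simp only [Equiv.coe_toEmbedding, Finset.map_univ_equiv] at h1
  rw [h1, hoeffdingKernel_eq_hoeffdingPart hm hs]
  congr 1
  funext x
  exact hs σ x

theorem isDegenerate_of_condMean {f : (Fin (m + 1) → E) → ℝ} (hf : Measurable f)
    (hi : Integrable f (Measure.pi fun _ => μ))
    (h0 : condMean μ {(0 : Fin (m + 1))}ᶜ f =ᵐ[Measure.pi fun _ => μ] fun _ => 0) :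
    IsDegenerate μ f := by
  refine ⟨hi, ?_⟩
  have hmp := measurePreserving_comp_injective μ (Fin.succ_injective m)
  rw [← hmp.map_eq, ae_map_iff hmp.measurable.aemeasurable]
  · filter_upwards [h0] with x hx
    rw [← hx]
    refine Eq.trans (integral_comp_eval μ (0 : Fin (m + 1))
      (hf.comp (measurable_cons.comp measurable_prodMk_left))).symm ?_
    refine integral_congr_ae (Filter.Eventually.of_forall fun y =>
      congrArg f (funext fun k => ?_))
    refine Fin.cases ?_ (fun k => ?_) k
    · simp
    · simp [Finset.piecewise]
  -- Transferring an almost everywhere statement to the image measure requires a measurable set.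
  · have hc : StronglyMeasurable (Function.uncurry fun (x : Fin m → E) (y : E) =>
        f (Fin.cons y x : Fin (m + 1) → E)) :=
      (hf.comp measurable_cons).stronglyMeasurable
    exact measurableSet_eq_fun hc.integral_prod_right.measurable measurable_const

end HoeffdingKernel

/-- Matching the fibres gives one solution `σ₀`; all solutions form a coset of the stabilizer of
`f`, whose order is the product of the fibre factorials. -/
theorem card_perm_comp_eq {α β : Type*} [Fintype α] [DecidableEq α] [Fintype β] [DecidableEq β]
    (f g : α → β)
    (h : ∀ b, Fintype.card {a // f a = b} = Fintype.card {a // g a = b}) :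
    Fintype.card {σ : Equiv.Perm α // g ∘ σ = f} =
      ∏ b, (Fintype.card {a // f a = b}).factorial := by
  classical
  let σ₀ : Equiv.Perm α := Equiv.ofFiberEquiv fun b => Fintype.equivOfCardEq (h b)
  have hσ₀ : g ∘ σ₀ = f := funext fun a => Equiv.ofFiberEquiv_map _ a
  rw [← DomMulAct.stabilizer_card f]
  refine Fintype.card_congr ((Equiv.mulLeft σ₀⁻¹).subtypeEquiv fun σ => ?_)
  have : f ∘ (σ₀⁻¹ * σ : Equiv.Perm α) = g ∘ σ := by
    rw [← hσ₀]
    funext a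
    simp
  simp only [Equiv.coe_mulLeft]
  rw [this]

/-! ### Double counting of compatible pairs and arrangements. -/

section Counting

variable {ι : Type*} [Fintype ι] [DecidableEq ι] {m p q r l : ℕ}

/-- The arrangement `d` of a set lists first the `r - l` points of `A ∩ B`, then the `p - r`
points of `A \ B` and finally the `q - r` points of `B \ A`. -/
def IsArranged (p r l : ℕ) (d : Fin m → ι) (A B : Finset ι) : Prop :=
  ∀ i : Fin m, (d i ∈ A ↔ i.1 < p - l) ∧ (d i ∈ B ↔ (i.1 < r - l ∨ p - l ≤ i.1))

instance (d : Fin m → ι) (A B : Finset ι) : Decidable (IsArranged p r l d A B) := by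
  unfold IsArranged
  infer_instance

/-- Pairs of sets with `r` common points for which `symmDiff A B ⊆ M ⊆ A ∪ B`. -/
def IsCompatible (M : Finset ι) (r : ℕ) (A B : Finset ι) : Prop :=
  (∀ i, i ∈ M → i ∈ A ∨ i ∈ B) ∧ (∀ i, i ∉ M → (i ∈ A ↔ i ∈ B)) ∧ (A ∩ B).card = r

instance (M : Finset ι) (r : ℕ) (A B : Finset ι) : Decidable (IsCompatible M r A B) := by
  unfold IsCompatible
  infer_instance

theorem card_fin_filter (m a b : ℕ) (hb : b ≤ m) :
    (Finset.univ.filter fun i : Fin m => a ≤ i.1 ∧ i.1 < b).card = b - a := by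
  rw [← Nat.card_Ico, ← Finset.card_map Fin.valEmbedding]
  congr 1
  ext k
  simp only [Finset.mem_map, Finset.mem_filter, Finset.mem_univ, true_and, Fin.valEmbedding_apply,
    Finset.mem_Ico]
  exact ⟨by rintro ⟨i, hi, rfl⟩; exact hi, fun hk => ⟨⟨k, by omega⟩, hk, rfl⟩⟩

theorem card_arrangements (hlr : l ≤ r) (hrp : r ≤ p) (hrq : r ≤ q) (hm : m + r + l = p + q)
    (e : Fin m ↪ ι) {A B : Finset ι} (hA : A.card = p) (hB : B.card = q)
    (h : IsCompatible (Finset.univ.map e) r A B) :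
    (Finset.univ.filter fun σ : Equiv.Perm (Fin m) =>
      IsArranged p r l (fun i => e (σ i)) A B).card =
      (r - l).factorial * (p - r).factorial * (q - r).factorial := by
  obtain ⟨h1, h2, h3⟩ := h
  -- `f` codes the membership prescribed at a position and `g` the actual one, so arrangements are
  -- the solutions of `g ∘ σ = f`.
  let f : Fin m → Bool × Bool := fun i =>
    (decide (i.1 < p - l), decide (i.1 < r - l ∨ p - l ≤ i.1))
  let g : Fin m → Bool × Bool := fun i => (decide (e i ∈ A), decide (e i ∈ B))
  have hAB : (A \ B).card = p - r := by
    have := Finset.card_sdiff_add_card_inter A B; omega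
  have hBA : (B \ A).card = q - r := by
    have := Finset.card_sdiff_add_card_inter B A
    rw [Finset.inter_comm] at this; omega
  have fTF : Fintype.card {i // f i = (true, false)} = p - r := by
    rw [Fintype.card_subtype, show p - r = (p - l) - (r - l) by omega,
      ← card_fin_filter m (r - l) (p - l) (by omega)]
    congr 1; ext i; simp [f]; omega
  have fFT : Fintype.card {i // f i = (false, true)} = q - r := by
    rw [Fintype.card_subtype, show q - r = m - (p - l) by omega,
      ← card_fin_filter m (p - l) m le_rfl]
    congr 1; ext i; simp [f]; omega
  have fTT : Fintype.card {i // f i = (true, true)} = r - l := by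
    rw [Fintype.card_subtype, show r - l = (r - l) - 0 by omega,
      ← card_fin_filter m 0 (r - l) (by omega)]
    congr 1; ext i; simp [f]; omega
  have fFF : Fintype.card {i // f i = (false, false)} = 0 := by
    rw [Fintype.card_subtype, Finset.card_eq_zero, Finset.filter_eq_empty_iff]
    intro i; simp [f]; omega
  have gTF : Fintype.card {i // g i = (true, false)} = p - r := by
    rw [Fintype.card_subtype, ← hAB, ← Finset.card_map e]
    congr 1; ext x
    simp only [g, Finset.mem_map, Finset.mem_filter, Finset.mem_univ, true_and, Prod.mk.injEq,
      decide_eq_true_eq, decide_eq_false_iff_not, Finset.mem_sdiff]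
    refine ⟨by rintro ⟨i, hi, rfl⟩; exact hi, fun hx => ?_⟩
    by_cases hxM : x ∈ Finset.univ.map e
    · obtain ⟨i, -, rfl⟩ := Finset.mem_map.1 hxM
      exact ⟨i, hx, rfl⟩
    · exact absurd ((h2 x hxM).1 hx.1) hx.2
  have gFT : Fintype.card {i // g i = (false, true)} = q - r := by
    rw [Fintype.card_subtype, ← hBA, ← Finset.card_map e]
    congr 1; ext x
    simp only [g, Finset.mem_map, Finset.mem_filter, Finset.mem_univ, true_and, Prod.mk.injEq,
      decide_eq_true_eq, decide_eq_false_iff_not, Finset.mem_sdiff]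
    refine ⟨by rintro ⟨i, hi, rfl⟩; exact hi.symm, fun hx => ?_⟩
    by_cases hxM : x ∈ Finset.univ.map e
    · obtain ⟨i, -, rfl⟩ := Finset.mem_map.1 hxM
      exact ⟨i, hx.symm, rfl⟩
    · exact absurd ((h2 x hxM).2 hx.1) hx.2
  have gFF : Fintype.card {i // g i = (false, false)} = 0 := by
    rw [Fintype.card_subtype, Finset.card_eq_zero, Finset.filter_eq_empty_iff]
    intro i _
    have := h1 (e i) (Finset.mem_map_of_mem e (Finset.mem_univ i))
    simp only [g, Prod.mk.injEq, decide_eq_false_iff_not]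
    tauto
  -- The last fibre size follows from the total `m`.
  have gTT : Fintype.card {i // g i = (true, true)} = r - l := by
    have htot : Fintype.card (Fin m) = ∑ b, Fintype.card {i // g i = b} := by
      rw [← Fintype.card_sigma]
      exact (Fintype.card_congr (Equiv.sigmaFiberEquiv g)).symm
    simp only [Fintype.sum_prod_type, Fintype.sum_bool, gTF, gFT, gFF, Fintype.card_fin] at htot
    omega
  have key := card_perm_comp_eq f g (by
    rintro ⟨_ | _, _ | _⟩
    · rw [fFF, gFF]
    · rw [fFT, gFT]
    · rw [fTF, gTF]
    · rw [fTT, gTT])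
  simp only [Fintype.prod_prod_type, Fintype.prod_bool, fTF, fFT, fTT, fFF, Nat.factorial_zero,
    mul_one] at key
  rw [← key, Fintype.card_subtype]
  congr 1
  ext σ
  rw [Finset.mem_filter_univ, Finset.mem_filter_univ]
  simp only [IsArranged, funext_iff, Function.comp_apply, f, g, Prod.mk.injEq, decide_eq_decide]

/-- The arrangement fixes `A ∩ M` and `B ∩ M`, while compatibility forces `A \ M = B \ M`. The only
freedom is this common part, an arbitrary `l`-subset of the complement of `M`. -/
theorem card_arranged_pairs (hlr : l ≤ r) (hrp : r ≤ p) (hrq : r ≤ q)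
    (hm : m + r + l = p + q) (d : Fin m ↪ ι) :
    (Finset.univ.filter fun z : {A : Finset ι // A.card = p} × {B : Finset ι // B.card = q} =>
      IsCompatible (Finset.univ.map d) r z.1.1 z.2.1 ∧ IsArranged p r l d z.1.1 z.2.1).card =
      (Fintype.card ι - m).choose l := by
  set M := Finset.univ.map d with hM
  have hdM : ∀ i, d i ∈ M := fun i => Finset.mem_map_of_mem d (Finset.mem_univ i)
  have hMd : ∀ x ∈ M, ∃ i, d i = x := fun x hx => by simpa [hM] using hx
  have hcM : Mᶜ.card = Fintype.card ι - m := by simp [hM, Finset.card_compl]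
  have hpart : ∀ (s : Finset ι) (P : Fin m → Prop) [DecidablePred P],
      (∀ i, d i ∈ s ↔ P i) → (s ∩ M).card = (Finset.univ.filter P).card := by
    intro s P _ hs
    rw [← Finset.card_map d]
    congr 1; ext x
    simp only [Finset.mem_inter, Finset.mem_map, Finset.mem_filter, Finset.mem_univ, true_and]
    constructor
    · rintro ⟨hx, hxM⟩
      obtain ⟨i, rfl⟩ := hMd x hxM
      exact ⟨i, (hs i).1 hx, rfl⟩
    · rintro ⟨i, hi, rfl⟩
      exact ⟨(hs i).2 hi, hdM i⟩
  have hcount1 : (Finset.univ.filter fun i : Fin m => i.1 < p - l).card = p - l := by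
    simpa using card_fin_filter m 0 (p - l) (by omega)
  have hcount2 : (Finset.univ.filter fun i : Fin m => i.1 < r - l ∨ p - l ≤ i.1).card =
      (r - l) + (q - r) := by
    rw [Finset.filter_or, Finset.card_union_of_disjoint]
    · congr 1
      · simpa using card_fin_filter m 0 (r - l) (by omega)
      · have := card_fin_filter m (p - l) m le_rfl
        simp only [Fin.is_lt, and_true] at this
        omega
    · rw [Finset.disjoint_filter]
      intro i _
      omega
  have hcount3 : (Finset.univ.filter fun i : Fin m =>
      i.1 < p - l ∧ (i.1 < r - l ∨ p - l ≤ i.1)).card = r - l := by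
    refine Eq.trans ?_ ((card_fin_filter m 0 (r - l) (by omega)).trans (Nat.sub_zero _))
    congr 1; ext i; simp; omega
  rw [← hcM, ← Finset.card_powersetCard]
  refine Finset.card_bij (fun z _ => z.1.1 \ M) ?_ ?_ ?_
  · rintro ⟨⟨A, hA⟩, ⟨B, hB⟩⟩ hz
    simp only [Finset.mem_filter, Finset.mem_univ, true_and] at hz
    obtain ⟨-, har⟩ := hz
    rw [Finset.mem_powersetCard]
    refine ⟨fun x hx => by simpa using (Finset.mem_sdiff.1 hx).2, ?_⟩
    have h1 := hpart A _ fun i => (har i).1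
    have h2 := Finset.card_sdiff_add_card_inter A M
    dsimp only
    omega
  · rintro ⟨⟨A, hA⟩, ⟨B, hB⟩⟩ hz ⟨⟨A', hA'⟩, ⟨B', hB'⟩⟩ hz' heq
    simp only [Finset.mem_filter, Finset.mem_univ, true_and] at hz hz' heq
    obtain ⟨⟨-, hc, -⟩, har⟩ := hz
    obtain ⟨⟨-, hc', -⟩, har'⟩ := hz'
    have hout : ∀ x, x ∉ M → (x ∈ A ↔ x ∈ A') := fun x hx => by
      have := Finset.ext_iff.1 heq x
      simpa [hx] using this
    have hAA : A = A' := by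
      ext x
      by_cases hx : x ∈ M
      · obtain ⟨i, rfl⟩ := hMd x hx
        rw [(har i).1, (har' i).1]
      · exact hout x hx
    have hBB : B = B' := by
      ext x
      by_cases hx : x ∈ M
      · obtain ⟨i, rfl⟩ := hMd x hx
        rw [(har i).2, (har' i).2]
      · rw [← hc x hx, ← hc' x hx, hout x hx]
    subst hAA hBB
    rfl
  · intro C hC
    rw [Finset.mem_powersetCard] at hC
    obtain ⟨hCM, hCl⟩ := hC
    have hCM' : ∀ x ∈ C, x ∉ M := fun x hx => Finset.mem_compl.1 (hCM hx)
    let A := C ∪ (Finset.univ.filter fun i : Fin m => i.1 < p - l).map d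
    let B := C ∪ (Finset.univ.filter fun i : Fin m => i.1 < r - l ∨ p - l ≤ i.1).map d
    have hdA : ∀ i, d i ∈ A ↔ i.1 < p - l := by
      intro i
      have : d i ∉ C := fun h => hCM' _ h (hdM i)
      simp [A, this]
    have hdB : ∀ i, d i ∈ B ↔ (i.1 < r - l ∨ p - l ≤ i.1) := by
      intro i
      have : d i ∉ C := fun h => hCM' _ h (hdM i)
      simp [B, this]
    have hoA : ∀ x, x ∉ M → (x ∈ A ↔ x ∈ C) := by
      intro x hx
      simp only [A, Finset.mem_union, or_iff_left_iff_imp]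
      intro h
      exact absurd (Finset.map_subset_map.2 (Finset.subset_univ _) h) hx
    have hoB : ∀ x, x ∉ M → (x ∈ B ↔ x ∈ C) := by
      intro x hx
      simp only [B, Finset.mem_union, or_iff_left_iff_imp]
      intro h
      exact absurd (Finset.map_subset_map.2 (Finset.subset_univ _) h) hx
    have hsd : ∀ s : Finset ι, (∀ x, x ∉ M → (x ∈ s ↔ x ∈ C)) → s \ M = C := by
      intro s hs
      ext x
      by_cases hx : x ∈ M
      · simp only [Finset.mem_sdiff, hx, not_true_eq_false, and_false, false_iff]
        exact fun h => hCM' x h hx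
      · simp [hx, hs x hx]
    have hcA : A.card = p := by
      have h1 := hpart A _ hdA
      have h2 := Finset.card_sdiff_add_card_inter A M
      rw [hsd A hoA] at h2
      omega
    have hcB : B.card = q := by
      have h1 := hpart B _ hdB
      have h2 := Finset.card_sdiff_add_card_inter B M
      rw [hsd B hoB] at h2
      omega
    have hcAB : (A ∩ B).card = r := by
      have h1 := hpart (A ∩ B) (fun i => i.1 < p - l ∧ (i.1 < r - l ∨ p - l ≤ i.1))
        fun i => by rw [Finset.mem_inter, hdA, hdB]
      have h2 := Finset.card_sdiff_add_card_inter (A ∩ B) M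
      rw [hsd (A ∩ B) fun x hx => by rw [Finset.mem_inter, hoA x hx, hoB x hx, and_self]] at h2
      omega
    refine ⟨⟨⟨A, hcA⟩, ⟨B, hcB⟩⟩, ?_, hsd A hoA⟩
    simp only [Finset.mem_filter, Finset.mem_univ, true_and]
    refine ⟨⟨fun x hx => ?_, fun x hx => by rw [hoA x hx, hoB x hx], hcAB⟩,
      fun i => ⟨hdA i, hdB i⟩⟩
    obtain ⟨i, rfl⟩ := hMd x hx
    rw [hdA, hdB]
    omega

/-- Count pairs `(z, σ)` twice: each `z` has `N` arrangements, each `σ` arranges a binomial number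
of pairs, and `N` times the multinomial coefficient is `m!`. -/
theorem sum_compatible_pairs (hlr : l ≤ r) (hrp : r ≤ p) (hrq : r ≤ q)
    (hm : m + r + l = p + q) (e : Fin m ↪ ι)
    (H : {A : Finset ι // A.card = p} × {B : Finset ι // B.card = q} → ℝ)
    (c : Equiv.Perm (Fin m) → ℝ)
    (hc : ∀ z σ, IsCompatible (Finset.univ.map e) r z.1.1 z.2.1 →
      IsArranged p r l (fun i => e (σ i)) z.1.1 z.2.1 → H z = c σ) :
    ∑ z : {A : Finset ι // A.card = p} × {B : Finset ι // B.card = q} with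
      IsCompatible (Finset.univ.map e) r z.1.1 z.2.1, H z =
      ((Fintype.card ι - m).choose l : ℝ) *
        (Nat.multinomial Finset.univ ![p - r, q - r, r - l] : ℝ) *
        (1 / (m.factorial : ℝ) * ∑ σ, c σ) := by
  set N := (r - l).factorial * (p - r).factorial * (q - r).factorial with hN
  have hN0 : (N : ℝ) ≠ 0 := by positivity
  have hmult : (Nat.multinomial Finset.univ ![p - r, q - r, r - l] : ℝ) * N = m.factorial := by
    have := Nat.multinomial_spec Finset.univ ![p - r, q - r, r - l]
    simp only [Fin.sum_univ_three, Fin.prod_univ_three, Matrix.cons_val_zero, Matrix.cons_val_one,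
      Matrix.cons_val] at this
    rw [show p - r + (q - r) + (r - l) = m by omega] at this
    rw [← this, hN]
    push_cast
    ring
  have hdouble : (∑ z : {A : Finset ι // A.card = p} × {B : Finset ι // B.card = q} with
      IsCompatible (Finset.univ.map e) r z.1.1 z.2.1, H z) * N =
      ((Fintype.card ι - m).choose l : ℝ) * ∑ σ, c σ := by
    calc (∑ z : {A : Finset ι // A.card = p} × {B : Finset ι // B.card = q} with
          IsCompatible (Finset.univ.map e) r z.1.1 z.2.1, H z) * N
        = ∑ z : {A : Finset ι // A.card = p} × {B : Finset ι // B.card = q} with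
            IsCompatible (Finset.univ.map e) r z.1.1 z.2.1,
            ∑ σ : Equiv.Perm (Fin m) with IsArranged p r l (fun i => e (σ i)) z.1.1 z.2.1,
              c σ := by
          rw [Finset.sum_mul]
          refine Finset.sum_congr rfl fun z hz => ?_
          have hz' := (Finset.mem_filter.1 hz).2
          rw [hN, ← card_arrangements hlr hrp hrq hm e z.1.2 z.2.2 hz',
            Finset.sum_congr rfl fun σ hσ => (hc z σ hz' (Finset.mem_filter.1 hσ).2).symm,
            Finset.sum_const, nsmul_eq_mul, mul_comm]
      _ = ∑ σ, ∑ z : {A : Finset ι // A.card = p} × {B : Finset ι // B.card = q} with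
            IsCompatible (Finset.univ.map e) r z.1.1 z.2.1 ∧
              IsArranged p r l (fun i => e (σ i)) z.1.1 z.2.1, c σ := by
          refine Finset.sum_comm' ?_
          simp
      _ = _ := by
          rw [Finset.mul_sum]
          refine Finset.sum_congr rfl fun σ _ => ?_
          have := card_arranged_pairs hlr hrp hrq hm (σ.toEmbedding.trans e)
          rw [← Finset.map_map, Finset.map_univ_equiv] at this
          rw [Finset.sum_const, nsmul_eq_mul, ← this]
          rfl
  have hmf : (m.factorial : ℝ) ≠ 0 := by positivity
  rw [← mul_left_inj' hN0, hdouble]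
  field_simp
  rw [← hmult]
  ring

end Counting

/-! ### From means on the product space to conditional expectations. -/

section CondExp

variable {Ω E : Type*} {mΩ : MeasurableSpace Ω} [MeasurableSpace E] {n : ℕ}
  {P : Measure Ω} [IsProbabilityMeasure P] {μ : Measure E} [IsProbabilityMeasure μ]
  {X : Fin n → Ω → E}

theorem sampleSigma_le (hX : ∀ i, Measurable (X i)) (J : Finset (Fin n)) :
    sampleSigma X J ≤ mΩ :=
  iSup₂_le fun j _ => (hX j).comap_le

theorem measurable_sampleSigma {J : Finset (Fin n)} {j : Fin n} (hj : j ∈ J) :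
    Measurable[sampleSigma X J] (X j) := by
  rw [measurable_iff_comap_le]
  exact le_iSup₂_of_le j hj le_rfl

theorem condExp_comp_sample (hX : ∀ i, Measurable (X i))
    (hmap : MeasurePreserving (fun ω i => X i ω) P (Measure.pi fun _ : Fin n => μ))
    (J : Finset (Fin n)) {F : (Fin n → E) → ℝ} (hFm : Measurable F)
    (hF : Integrable F (Measure.pi fun _ => μ)) :
    P[fun ω => F fun i => X i ω | sampleSigma X J] =ᵐ[P]
      fun ω => condMean μ J F fun i => X i ω := by
  obtain ⟨c⟩ : Nonempty E := nonempty_of_isProbabilityMeasure μ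
  -- Freezing the coordinates outside `J` at an arbitrary point makes `T` measurable for `F_J`, and
  -- every event of `F_J` is a preimage under `T`.
  let T : Ω → Fin n → E := fun ω => J.piecewise (fun i => X i ω) fun _ => c
  have hT : Measurable[sampleSigma X J] T := by
    refine @measurable_pi_lambda _ _ _ (sampleSigma X J) _ _ fun i => ?_
    by_cases hi : i ∈ J
    · simpa [T, hi] using measurable_sampleSigma hi
    · simp [T, hi]
  have hcT : Measurable fun x : Fin n → E => J.piecewise x fun _ => c :=
    (measurable_piecewise_prod J).comp measurable_prodMk_right
  have hle : sampleSigma X J ≤ MeasurableSpace.comap T inferInstance := by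
    refine iSup₂_le fun j hj => ?_
    have : X j = (fun x => x j) ∘ T := by
      funext ω
      simp [T, hj]
    rw [this, ← MeasurableSpace.comap_comp]
    exact MeasurableSpace.comap_mono (measurable_pi_apply j).comap_le
  have hint := integrable_condMean J hF
  refine (ae_eq_condExp_of_forall_setIntegral_eq (sampleSigma_le hX J)
    (hmap.integrable_comp_of_integrable hF)
    (fun s _ _ => (hmap.integrable_comp_of_integrable hint).integrableOn) ?_ ?_).symm
  · intro s hs _
    obtain ⟨B, hB, rfl⟩ := hle s hs
    let D : Set (Fin n → E) := {x | (J.piecewise x fun _ => c) ∈ B}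
    have hD : MeasurableSet D := hcT hB
    have hset : ∀ {G : (Fin n → E) → ℝ}, Measurable G →
        ∫ ω in T ⁻¹' B, G (fun i => X i ω) ∂P =
          ∫ x, D.indicator G x ∂(Measure.pi fun _ => μ) := by
      intro G hG
      rw [integral_indicator hD, ← hmap.map_eq, setIntegral_map hD hG.aestronglyMeasurable
        hmap.measurable.aemeasurable]
      rfl
    refine (hset (measurable_condMean J hFm)).trans (Eq.trans ?_ (hset hFm).symm)
    have hmp := measurePreserving_piecewise μ J
    have hDF := hF.indicator hD
    conv_rhs => rw [← hmp.map_eq]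
    rw [integral_map hmp.measurable.aemeasurable
      (hmp.map_eq.symm ▸ hDF.aestronglyMeasurable),
      integral_prod _ (integrable_comp_piecewise J hDF)]
    congr 1
    funext x
    -- `D` constrains only coordinates in `J`, so its indicator passes through the inner integral.
    have hmem : ∀ y, J.piecewise x y ∈ D ↔ x ∈ D := by
      intro y
      have : (J.piecewise (J.piecewise x y) fun _ => c) = J.piecewise x fun _ => c := by
        ext i
        by_cases hi : i ∈ J <;> simp [hi]
      simp only [D, Set.mem_ofPred_eq, this]
    by_cases hx : x ∈ D
    · simp [Set.indicator, hx, hmem, condMean]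
    · simp [Set.indicator, hx, hmem]
  · have : (fun ω => condMean μ J F fun i => X i ω) = fun ω => condMean μ J F (T ω) := by
      funext ω
      simp only [condMean]
      congr 1
      funext y
      congr 1
      ext i
      by_cases hi : i ∈ J <;> simp [T, hi]
    change AEStronglyMeasurable[sampleSigma X J] (fun ω => condMean μ J F fun i => X i ω) P
    rw [this]
    exact ((measurable_condMean J hFm).comp hT).aestronglyMeasurable

end CondExp

/-! ### Components of a single product, and properties of the kernels `χ`. -/

section ProductFormula

variable {E : Type*} [MeasurableSpace E] {μ : Measure E} [IsProbabilityMeasure μ]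
  {n p q m t : ℕ} {ψ : (Fin p → E) → ℝ} {φ : (Fin q → E) → ℝ}

/-- The product `ψ (x_A) φ (x_B)` for a `p`-set `A` and a `q`-set `B` of indices. -/
def pairProduct (ψ : (Fin p → E) → ℝ) (φ : (Fin q → E) → ℝ)
    (z : {A : Finset (Fin n) // A.card = p} × {B : Finset (Fin n) // B.card = q}) :
    (Fin n → E) → ℝ :=
  fun x => ψ (fun i => x (z.1.1.orderEmbOfFin z.1.2 i)) *
    φ (fun i => x (z.2.1.orderEmbOfFin z.2.2 i))

/-- The factor `1` gives the weighted form expected by `hoeffdingPart_sum`. -/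
theorem uSum_mul_uSum (x : Fin n → E) :
    uSum x ψ * uSum x φ = ∑ z, 1 * pairProduct ψ φ z x := by
  simp only [uSum, one_mul, pairProduct]
  rw [Fintype.sum_mul_sum, Fintype.sum_prod_type]

theorem integrable_pairProduct (hψ : MemLp ψ 2 (Measure.pi fun _ => μ))
    (hφ : MemLp φ 2 (Measure.pi fun _ => μ))
    (z : {A : Finset (Fin n) // A.card = p} × {B : Finset (Fin n) // B.card = q}) :
    Integrable (pairProduct ψ φ z) (Measure.pi fun _ => μ) :=
  integrable_mul_comp hψ hφ (z.1.1.orderEmbOfFin z.1.2).injective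
    (z.2.1.orderEmbOfFin z.2.2).injective

theorem exists_orderEmbOfFin_eq {s : Finset (Fin n)} {k : ℕ} (hs : s.card = k) {j : Fin n}
    (hj : j ∈ s) : ∃ i, s.orderEmbOfFin hs i = j := by
  rw [← Set.mem_range, Finset.range_orderEmbOfFin]
  exact hj

theorem hoeffdingPart_pairProduct_of_not_compatible
    (hψm : Measurable ψ) (hφm : Measurable φ) (hψs : IsSymmetric ψ) (hφs : IsSymmetric φ)
    (hψ : MemLp ψ 2 (Measure.pi fun _ => μ)) (hφ : MemLp φ 2 (Measure.pi fun _ => μ))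
    (hψd : IsDegenerate μ ψ) (hφd : IsDegenerate μ φ) {M : Finset (Fin n)}
    {z : {A : Finset (Fin n) // A.card = p} × {B : Finset (Fin n) // B.card = q}}
    (hz : ∀ r, ¬ IsCompatible M r z.1.1 z.2.1) :
    hoeffdingPart μ M (pairProduct ψ φ z) =ᵐ[Measure.pi fun _ => μ] fun _ => 0 := by
  obtain ⟨⟨A, hA⟩, ⟨B, hB⟩⟩ := z
  have hint := integrable_pairProduct hψ hφ (⟨⟨A, hA⟩, ⟨B, hB⟩⟩ :
    {A : Finset (Fin n) // A.card = p} × {B : Finset (Fin n) // B.card = q})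
  by_cases h1 : ∀ i, i ∈ M → i ∈ A ∨ i ∈ B
  · have h2 : ¬ ∀ i, i ∉ M → (i ∈ A ↔ i ∈ B) := fun h2 => hz _ ⟨h1, h2, rfl⟩
    push Not at h2
    obtain ⟨j, hjM, hj⟩ := h2
    have hMj : M ⊆ {j}ᶜ := fun i hi => by
      rw [Finset.mem_compl, Finset.mem_singleton]
      rintro rfl
      exact hjM hi
    refine hoeffdingPart_ae_zero_of_condMean hMj hint ?_
    rcases hj with ⟨hjA, hjB⟩ | ⟨hjA, hjB⟩
    · obtain ⟨i, rfl⟩ := exists_orderEmbOfFin_eq hA hjA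
      refine condMean_mul_degenerate hψm hψd hψs (A.orderEmbOfFin hA).injective i φ
        (b := B.orderEmbOfFin hB) fun k hk => hjB ?_
      rw [← hk]
      exact B.orderEmbOfFin_mem hB k
    · obtain ⟨i, rfl⟩ := exists_orderEmbOfFin_eq hB hjB
      have := condMean_mul_degenerate hφm hφd hφs (B.orderEmbOfFin hB).injective i ψ
        (b := A.orderEmbOfFin hA) fun k hk => hjA (by
          rw [← hk]
          exact A.orderEmbOfFin_mem hA k)
      simp only [mul_comm (φ _)] at this
      exact this
  · push Not at h1
    obtain ⟨j, hjM, hjA, hjB⟩ := h1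
    refine Filter.Eventually.of_forall fun x =>
      hoeffdingPart_eq_zero_of_not_depends hjM (fun x y hxy => ?_) x
    have hA' : ∀ i, x (A.orderEmbOfFin hA i) = y (A.orderEmbOfFin hA i) := fun i =>
      hxy _ fun h => hjA (h ▸ A.orderEmbOfFin_mem hA i)
    have hB' : ∀ i, x (B.orderEmbOfFin hB i) = y (B.orderEmbOfFin hB i) := fun i =>
      hxy _ fun h => hjB (h ▸ B.orderEmbOfFin_mem hB i)
    simp only [pairProduct, hA', hB']

/-- For `|M| = p + q - t` these bounds say `t ≤ 2r` and `r ≤ min t p q`, the summation range of `r`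
in `χ`. -/
theorem IsCompatible.card_bounds {M A B : Finset (Fin n)} {r : ℕ} (h : IsCompatible M r A B) :
    M.card + r ≤ A.card + B.card ∧ A.card + B.card ≤ M.card + 2 * r ∧
      r ≤ A.card ∧ r ≤ B.card := by
  obtain ⟨h1, h2, h3⟩ := h
  have hu : M.card ≤ (A ∪ B).card :=
    Finset.card_le_card fun i hi => Finset.mem_union.2 (h1 i hi)
  have huc := Finset.card_union_add_card_inter A B
  have hl : (A ∪ B).card ≤ (M ∪ (A ∩ B)).card := Finset.card_le_card fun i hi => by
    by_cases hM : i ∈ M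
    · exact Finset.mem_union_left _ hM
    · have := h2 i hM
      rw [Finset.mem_union] at hi
      exact Finset.mem_union_right _ (Finset.mem_inter.2 (by tauto))
  have hl2 := Finset.card_union_le M (A ∩ B)
  have hA := Finset.card_le_card (Finset.inter_subset_left (s₁ := A) (s₂ := B))
  have hB := Finset.card_le_card (Finset.inter_subset_right (s₁ := A) (s₂ := B))
  omega

theorem condMean_pairProduct (hψm : Measurable ψ) (hφm : Measurable φ)
    (hψs : IsSymmetric ψ) (hφs : IsSymmetric φ) {r l : ℕ}
    (hlr : l ≤ r) (hrp : r ≤ p) (hrq : r ≤ q) (hm : m + r + l = p + q) (d : Fin m ↪ Fin n)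
    (z : {A : Finset (Fin n) // A.card = p} × {B : Finset (Fin n) // B.card = q})
    (hz : IsCompatible (Finset.univ.map d) r z.1.1 z.2.1)
    (har : IsArranged p r l d z.1.1 z.2.1) (x : Fin n → E) :
    condMean μ (Finset.univ.map d) (pairProduct ψ φ z) x =
      contraction μ ψ φ r l hlr hrp hrq hm fun i => x (d i) := by
  obtain ⟨⟨A, hA⟩, ⟨B, hB⟩⟩ := z
  obtain ⟨h1, h2, h3⟩ := hz
  dsimp only at h1 h2 h3 har
  set M := Finset.univ.map d with hM
  have hdM : ∀ i, d i ∈ M := fun i => Finset.mem_map_of_mem d (Finset.mem_univ i)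
  have hC : ((A ∩ B) \ M).card = l := by
    have hun : (A ∪ B).card = p + q - r := by
      have := Finset.card_union_add_card_inter A B
      omega
    -- Outside `M` the two sets agree, and the union has known size and contains `M`.
    have heq : (A ∩ B) \ M = (A ∪ B) \ M := by
      ext i
      simp only [Finset.mem_sdiff, Finset.mem_inter, Finset.mem_union]
      have := h2 i
      tauto
    rw [heq, Finset.card_sdiff_of_subset fun i hi => Finset.mem_union.2 (h1 i hi), hun]
    simp [hM]
    omega
  set c := ((A ∩ B) \ M).orderEmbOfFin hC with hc
  have hcmem : ∀ i, c i ∈ A ∧ c i ∈ B ∧ c i ∉ M := fun i => by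
    have := ((A ∩ B) \ M).orderEmbOfFin_mem hC i
    rw [Finset.mem_sdiff, Finset.mem_inter] at this
    exact ⟨this.1.1, this.1.2, this.2⟩
  have hcd : ∀ i j, c i ≠ d j := fun i j h => (hcmem i).2.2 (h ▸ hdM j)
  have ha := leftIndex_injective (p := p) (by omega) c.injective d.injective hcd
  have hb := rightIndex_injective hlr hrp hrq hm c.injective d.injective hcd
  rw [← condMean_mul_eq_contraction hψm hφm hlr hrp hrq hm c.injective
    (fun i => (hcmem i).2.2) hdM]
  congr 1
  funext y
  simp only [pairProduct]
  congr 1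
  · refine (hψs.comp_eq ha (fun i => exists_orderEmbOfFin_eq hA ?_) y).symm
    unfold leftIndex
    split_ifs with h
    · exact (hcmem _).1
    · exact (har _).1.2 (by dsimp only; omega)
  · refine (hφs.comp_eq hb (fun i => exists_orderEmbOfFin_eq hB ?_) y).symm
    unfold rightIndex
    split_ifs with h h'
    · exact (hcmem _).2.1
    · exact (har _).2.2 (by dsimp only; omega)
    · exact (har _).2.2 (by dsimp only; omega)

variable (hψm : Measurable ψ) (hφm : Measurable φ)
  (hψ : MemLp ψ 2 (Measure.pi fun _ => μ)) (hφ : MemLp φ 2 (Measure.pi fun _ => μ))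

include hψm hφm

theorem measurable_productKernel (n : ℕ) (hm : m + t = p + q) :
    Measurable (productKernel n μ ψ φ t hm) := by
  unfold productKernel
  refine Finset.measurable_fun_sum _ fun r _ => Measurable.const_mul ?_ _
  exact measurable_hoeffdingKernel (measurable_symmetrize (measurable_contraction hψm hφm _ _ _ _))
    (isSymmetric_symmetrize _)

theorem isSymmetric_productKernel (n : ℕ) (hm : m + t = p + q) :
    IsSymmetric (productKernel n μ ψ φ t hm) := by
  intro σ x
  unfold productKernel
  refine Finset.sum_congr rfl fun r _ => congrArg _ ?_
  exact isSymmetric_hoeffdingKernel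
    (measurable_symmetrize (measurable_contraction hψm hφm _ _ _ _)) (isSymmetric_symmetrize _) σ x

include hψ hφ

theorem integrable_productKernel (n : ℕ) (hm : m + t = p + q) :
    Integrable (productKernel n μ ψ φ t hm) (Measure.pi fun _ => μ) := by
  unfold productKernel
  refine integrable_finsetSum _ fun r _ => Integrable.const_mul ?_ _
  exact integrable_hoeffdingKernel
    (measurable_symmetrize (measurable_contraction hψm hφm _ _ _ _)) (isSymmetric_symmetrize _)
    (integrable_symmetrize (integrable_contraction hψm hφm hψ hφ _ _ _ _))

theorem isDegenerate_productKernel (n : ℕ) (hm : m + t = p + q) :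
    IsDegenerate μ (productKernel n μ ψ φ t hm) := by
  obtain _ | m := m
  · trivial
  refine isDegenerate_of_condMean (measurable_productKernel hψm hφm n hm)
    (integrable_productKernel hψm hφm hψ hφ n hm) ?_
  unfold productKernel
  refine (condMean_sum _ _ _ fun r _ => integrable_hoeffdingKernel
    (measurable_symmetrize (measurable_contraction hψm hφm _ _ _ _)) (isSymmetric_symmetrize _)
    (integrable_symmetrize (integrable_contraction hψm hφm hψ hφ _ _ _ _))).trans ?_
  refine Filter.EventuallyEq.trans (Filter.Eventually.mono ((Filter.eventually_all).2 fun r => ?_)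
    fun x hx => Finset.sum_congr rfl fun r _ => congrArg _ (hx r)) (g := fun x =>
      ∑ r : {r : ℕ // r ∈ Finset.Icc ((t + 1) / 2) (min t (min p q))},
        ((n - p - q + t).choose (t - r.1) : ℝ) *
        (Nat.multinomial Finset.univ ![p - r.1, q - r.1, 2 * r.1 - t] : ℝ) * 0)
    (Filter.Eventually.of_forall fun x => by simp)
  rw [hoeffdingKernel_eq_hoeffdingPart
    (measurable_symmetrize (measurable_contraction hψm hφm _ _ _ _)) (isSymmetric_symmetrize _)]
  -- A top-order component has mean zero given all coordinates but the first, because the full index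
  -- set is not contained in `{0}ᶜ`.
  exact condMean_hoeffdingPart (fun hsub => by simpa using hsub (Finset.mem_univ 0))
    (integrable_symmetrize (integrable_contraction hψm hφm hψ hφ _ _ _ _))

end ProductFormula

/-! ### Components of the product of two `U`-statistics and their transfer to the sample. -/

section ProductFormulaSample

variable {E : Type*} [MeasurableSpace E] {μ : Measure E} [IsProbabilityMeasure μ]
  {n p q m t : ℕ} {ψ : (Fin p → E) → ℝ} {φ : (Fin q → E) → ℝ}

theorem productKernel_comp (hψm : Measurable ψ) (hφm : Measurable φ)
    (hψs : IsSymmetric ψ) (hφs : IsSymmetric φ) (hn : p + q ≤ n) (hm : m + t = p + q)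
    (e : Fin m ↪ Fin n) (x : Fin n → E) :
    productKernel n μ ψ φ t hm (fun i => x (e i)) =
      ∑ r : {r : ℕ // r ∈ Finset.Icc ((t + 1) / 2) (min t (min p q))},
        hoeffdingPart μ (Finset.univ.map e) (fun x => ∑ z ∈ Finset.univ.filter fun
          z : {A : Finset (Fin n) // A.card = p} × {B : Finset (Fin n) // B.card = q} =>
            IsCompatible (Finset.univ.map e) r.1 z.1.1 z.2.1,
          1 * condMean μ (Finset.univ.map e) (pairProduct ψ φ z) x) x := by
  unfold productKernel
  refine Finset.sum_congr rfl fun r _ => ?_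
  have hr := Finset.mem_Icc.1 r.2
  have hlr : t - r.1 ≤ r.1 := by omega
  have hrp : r.1 ≤ p := by omega
  have hrq : r.1 ≤ q := by omega
  have hml : m + r.1 + (t - r.1) = p + q := by omega
  rw [hoeffdingKernel_comp (measurable_symmetrize (measurable_contraction hψm hφm hlr hrp hrq hml))
    (isSymmetric_symmetrize _), ← hoeffdingPart_const_mul]
  congr 1
  funext y
  simp only [one_mul]
  rw [sum_compatible_pairs hlr hrp hrq hml e
    (fun z => condMean μ (Finset.univ.map e) (pairProduct ψ φ z) y)
    (fun σ => contraction μ ψ φ r.1 (t - r.1) hlr hrp hrq hml fun i => y (e (σ i)))]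
  -- With truncated subtraction this equality rests on `p + q ≤ n`.
  · rw [show Fintype.card (Fin n) - m = n - p - q + t by rw [Fintype.card_fin]; omega,
      show r.1 - (t - r.1) = 2 * r.1 - t by omega]
    rfl
  · intro z σ hz har
    have := condMean_pairProduct (μ := μ) hψm hφm hψs hφs hlr hrp hrq hml (σ.toEmbedding.trans e) z
      (by rwa [← Finset.map_map, Finset.map_univ_equiv]) har y
    rw [← Finset.map_map, Finset.map_univ_equiv] at this
    exact this

theorem hoeffdingPart_uSum_mul_uSum (hψm : Measurable ψ) (hφm : Measurable φ)
    (hψs : IsSymmetric ψ) (hφs : IsSymmetric φ)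
    (hψ : MemLp ψ 2 (Measure.pi fun _ => μ)) (hφ : MemLp φ 2 (Measure.pi fun _ => μ))
    (hψd : IsDegenerate μ ψ) (hφd : IsDegenerate μ φ) (hn : p + q ≤ n) (hm : m + t = p + q)
    (e : Fin m ↪ Fin n) :
    hoeffdingPart μ (Finset.univ.map e) (fun x : Fin n → E => uSum x ψ * uSum x φ)
      =ᵐ[Measure.pi fun _ => μ] fun x => productKernel n μ ψ φ t hm fun i => x (e i) := by
  set M := Finset.univ.map e with hM
  have hMc : M.card = m := by simp [hM]
  have hint := fun z => integrable_pairProduct (n := n) hψ hφ z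
  have h1 := hoeffdingPart_sum (μ := μ) Finset.univ M (fun _ => (1 : ℝ)) fun z _ => hint z
  have h2 : ∀ᵐ x ∂(Measure.pi fun _ : Fin n => μ), ∀ z,
      hoeffdingPart μ M (condMean μ M (pairProduct ψ φ z)) x =
        hoeffdingPart μ M (pairProduct ψ φ z) x :=
    Filter.eventually_all.2 fun z => hoeffdingPart_condMean M (hint z)
  have h3 : ∀ᵐ x ∂(Measure.pi fun _ : Fin n => μ), ∀ z :
      {A : Finset (Fin n) // A.card = p} × {B : Finset (Fin n) // B.card = q},
      (∀ r, ¬ IsCompatible M r z.1.1 z.2.1) → hoeffdingPart μ M (pairProduct ψ φ z) x = 0 := by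
    refine Filter.eventually_all.2 fun z => ?_
    by_cases hz : ∀ r, ¬ IsCompatible M r z.1.1 z.2.1
    · filter_upwards [hoeffdingPart_pairProduct_of_not_compatible hψm hφm hψs hφs hψ hφ hψd hφd
        hz] with x hx _ using hx
    · exact Filter.Eventually.of_forall fun x h => absurd h hz
  have h4 : ∀ᵐ x ∂(Measure.pi fun _ : Fin n => μ),
      ∀ r : {r : ℕ // r ∈ Finset.Icc ((t + 1) / 2) (min t (min p q))}, _ :=
    Filter.eventually_all.2 fun r => hoeffdingPart_sum (μ := μ) (Finset.univ.filter fun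
      z : {A : Finset (Fin n) // A.card = p} × {B : Finset (Fin n) // B.card = q} =>
        IsCompatible M r.1 z.1.1 z.2.1) M (fun _ => (1 : ℝ))
      fun z _ => integrable_condMean M (hint z)
  filter_upwards [h1, h2, h3, h4] with x hx1 hx2 hx3 hx4
  rw [productKernel_comp hψm hφm hψs hφs hn hm e x, ← hM, Finset.sum_congr rfl fun r _ => hx4 r,
    funext fun x => uSum_mul_uSum x, hx1]
  simp only [one_mul, hx2, Finset.sum_filter]
  rw [Finset.sum_comm]
  refine Finset.sum_congr rfl fun z _ => ?_
  by_cases hz : ∀ r, ¬ IsCompatible M r z.1.1 z.2.1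
  · rw [hx3 z hz, Finset.sum_eq_zero fun r _ => if_neg (hz r.1)]
  · push Not at hz
    obtain ⟨r, hr⟩ := hz
    have hb := hr.card_bounds
    rw [z.1.2, z.2.2, hMc] at hb
    -- Each compatible pair counts for exactly one `r`, namely `|A ∩ B|`.
    rw [Finset.sum_eq_single ⟨r, Finset.mem_Icc.2 (by omega)⟩]
    · rw [if_pos hr]
    · intro r' _ hne
      refine if_neg fun hr' => hne (Subtype.ext ?_)
      exact hr'.2.2.symm.trans hr.2.2
    · simp

/-- By `card_bounds` no pair is compatible with a set of such size. The first conjunct of the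
negated condition encodes `|M| ≤ p + q` under truncated subtraction. -/
theorem hoeffdingPart_uSum_mul_uSum_eq_zero (hψm : Measurable ψ) (hφm : Measurable φ)
    (hψs : IsSymmetric ψ) (hφs : IsSymmetric φ)
    (hψ : MemLp ψ 2 (Measure.pi fun _ => μ)) (hφ : MemLp φ 2 (Measure.pi fun _ => μ))
    (hψd : IsDegenerate μ ψ) (hφd : IsDegenerate μ φ) {M : Finset (Fin n)}
    (hM : ¬ (M.card + (p + q - M.card) = p + q ∧ p + q ≤ M.card + 2 * min p q)) :
    hoeffdingPart μ M (fun x : Fin n → E => uSum x ψ * uSum x φ)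
      =ᵐ[Measure.pi fun _ => μ] fun _ => 0 := by
  have h1 := hoeffdingPart_sum (μ := μ) Finset.univ M (fun _ => (1 : ℝ))
    fun z _ => integrable_pairProduct (n := n) hψ hφ z
  have h2 : ∀ᵐ x ∂(Measure.pi fun _ : Fin n => μ), ∀ z,
      hoeffdingPart μ M (pairProduct ψ φ z) x = 0 := by
    refine Filter.eventually_all.2 fun z => hoeffdingPart_pairProduct_of_not_compatible
      hψm hφm hψs hφs hψ hφ hψd hφd fun r hr => hM ?_
    have hb := hr.card_bounds
    rw [z.1.2, z.2.2] at hb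
    omega
  filter_upwards [h1, h2] with x hx1 hx2
  rw [funext fun x => uSum_mul_uSum x, hx1]
  simp [hx2]

variable (μ ψ φ) in
/-- The summand indexed by `M` in the Hoeffding decomposition of `J_p(ψ) J_q(φ)`, as a function
of the sample. -/
noncomputable def productPart (M : Finset (Fin n)) : (Fin n → E) → ℝ :=
  fun x => if h : M.card + (p + q - M.card) = p + q ∧ p + q ≤ M.card + 2 * min p q then
    productKernel n μ ψ φ (p + q - M.card) h.1
      (fun i => x (M.orderEmbOfFin rfl i))
  else 0

theorem hoeffdingPart_eq_productPart (hψm : Measurable ψ) (hφm : Measurable φ)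
    (hψs : IsSymmetric ψ) (hφs : IsSymmetric φ)
    (hψ : MemLp ψ 2 (Measure.pi fun _ => μ)) (hφ : MemLp φ 2 (Measure.pi fun _ => μ))
    (hψd : IsDegenerate μ ψ) (hφd : IsDegenerate μ φ) (hn : p + q ≤ n) (M : Finset (Fin n)) :
    hoeffdingPart μ M (fun x : Fin n → E => uSum x ψ * uSum x φ)
      =ᵐ[Measure.pi fun _ => μ] productPart μ ψ φ M := by
  unfold productPart
  split_ifs with h
  · have := hoeffdingPart_uSum_mul_uSum hψm hφm hψs hφs hψ hφ hψd hφd hn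
      (m := M.card) (t := p + q - M.card) h.1 (M.orderEmbOfFin rfl).toEmbedding
    rw [Finset.map_orderEmbOfFin_univ] at this
    exact this
  · exact hoeffdingPart_uSum_mul_uSum_eq_zero hψm hφm hψs hφs hψ hφ hψd hφd h

theorem measurable_productPart (hψm : Measurable ψ) (hφm : Measurable φ) (M : Finset (Fin n)) :
    Measurable (productPart μ ψ φ M) := by
  unfold productPart
  split_ifs with h
  · exact (measurable_productKernel hψm hφm n _).comp
      (measurable_pi_lambda _ fun i => measurable_pi_apply _)
  · exact measurable_const

theorem integrable_productPart (hψm : Measurable ψ) (hφm : Measurable φ)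
    (hψ : MemLp ψ 2 (Measure.pi fun _ => μ)) (hφ : MemLp φ 2 (Measure.pi fun _ => μ))
    (M : Finset (Fin n)) : Integrable (productPart μ ψ φ M) (Measure.pi fun _ => μ) := by
  unfold productPart
  split_ifs with h
  · exact (measurePreserving_comp_injective μ
      (M.orderEmbOfFin rfl).injective).integrable_comp_of_integrable
      (integrable_productKernel hψm hφm hψ hφ n _)
  · exact integrable_zero _ _ _

theorem productKernel_orderEmbOfFin_congr {t' : ℕ} (J : Finset (Fin n)) (hJ : J.card = m)
    (h : m + t = p + q) (h' : J.card + t' = p + q) (x : Fin n → E) :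
    productKernel n μ ψ φ t h (fun i => x (J.orderEmbOfFin hJ i)) =
      productKernel n μ ψ φ t' h' (fun i => x (J.orderEmbOfFin rfl i)) := by
  subst hJ
  obtain rfl : t = t' := by omega
  rfl

theorem sum_uSum_productKernel
    (hm : ∀ t : Fin (2 * min p q + 1), p + q - t.1 + t.1 = p + q) (x : Fin n → E) :
    ∑ t, uSum x (productKernel n μ ψ φ t.1 (hm t)) =
      ∑ M, productPart μ ψ φ M x := by
  simp only [uSum]
  rw [← Fintype.sum_sigma']
  -- The size of `J` determines `t`, so the pairs `(t, J)` inject into the subsets; the parts of all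
  -- other subsets vanish.
  refine Fintype.sum_of_injective (fun z => z.2.1) ?_ _ _ ?_ ?_
  · rintro ⟨t, J, hJ⟩ ⟨t', J', hJ'⟩ heq
    dsimp only at heq
    subst heq
    obtain rfl : t = t' := by
      ext
      omega
    rfl
  · intro M hM
    unfold productPart
    refine dif_neg fun h => hM ⟨⟨⟨p + q - M.card, by omega⟩, M, ?_⟩, rfl⟩
    dsimp only
    omega
  · rintro ⟨t, J, hJ⟩
    unfold productPart
    dsimp only
    rw [dif_pos (by omega)]
    exact productKernel_orderEmbOfFin_congr J hJ _ _ x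

theorem isHoeffdingDecomposition_productPart {Ω : Type*} [MeasurableSpace Ω] {P : Measure Ω}
    [IsProbabilityMeasure P] {X : Fin n → Ω → E} (hX : ∀ i, Measurable (X i))
    (hmap : MeasurePreserving (fun ω i => X i ω) P (Measure.pi fun _ : Fin n => μ))
    (hψm : Measurable ψ) (hφm : Measurable φ)
    (hψs : IsSymmetric ψ) (hφs : IsSymmetric φ)
    (hψ : MemLp ψ 2 (Measure.pi fun _ => μ)) (hφ : MemLp φ 2 (Measure.pi fun _ => μ))
    (hψd : IsDegenerate μ ψ) (hφd : IsDegenerate μ φ) (hn : p + q ≤ n) :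
    IsHoeffdingDecomposition P X (fun ω => uStat X ψ ω * uStat X φ ω)
      (fun M ω => productPart μ ψ φ M fun i => X i ω) where
  integrable M := hmap.integrable_comp_of_integrable (integrable_productPart hψm hφm hψ hφ M)
  measurable M := by
    unfold productPart
    split_ifs with h
    -- Exact `F_M`-measurability is read off the explicit kernel, since the identity with
    -- `hoeffdingPart` is only almost everywhere.
    · refine (measurable_productKernel hψm hφm n _).comp ?_
      exact @measurable_pi_lambda _ _ _ (sampleSigma X M) _ _ fun i =>
        measurable_sampleSigma (M.orderEmbOfFin_mem rfl i)
    · exact measurable_const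
  condExp_eq_zero M J hMJ := by
    have hF : Integrable (fun x : Fin n → E => uSum x ψ * uSum x φ) (Measure.pi fun _ => μ) := by
      rw [funext fun x => uSum_mul_uSum x]
      exact integrable_finsetSum _ fun z _ => (integrable_pairProduct hψ hφ z).const_mul 1
    have h1 := condExp_comp_sample hX hmap J (measurable_productPart (μ := μ) hψm hφm M)
      (integrable_productPart hψm hφm hψ hφ M)
    have h2 := (condMean_congr J
      (hoeffdingPart_eq_productPart hψm hφm hψs hφs hψ hφ hψd hφd hn M)).symm.trans
      (condMean_hoeffdingPart hMJ hF)
    exact h1.trans (hmap.quasiMeasurePreserving.ae h2)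
  eq_sum := by
    have h : ∀ᵐ x ∂(Measure.pi fun _ : Fin n => μ), ∀ M,
        hoeffdingPart μ M (fun x : Fin n → E => uSum x ψ * uSum x φ) x =
          productPart μ ψ φ M x :=
      Filter.eventually_all.2 fun M =>
        hoeffdingPart_eq_productPart hψm hφm hψs hφs hψ hφ hψd hφd hn M
    filter_upwards [hmap.quasiMeasurePreserving.ae h] with ω hω
    rw [← Finset.sum_congr rfl fun M _ => hω M,
      sum_hoeffdingPart (μ := μ) (fun x : Fin n → E => uSum x ψ * uSum x φ)]
    rfl

end ProductFormulaSample

end UStat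

theorem mainTheorem5 {Ω E : Type*} [MeasurableSpace Ω] [MeasurableSpace E]
    (P : MeasureTheory.Measure Ω) [MeasureTheory.IsProbabilityMeasure P]
    (μ : MeasureTheory.Measure E) [MeasureTheory.IsProbabilityMeasure μ]
    (n p q : ℕ) (hp : 1 ≤ p) (hq : 1 ≤ q) (hn : p + q ≤ n)
    (X : Fin n → Ω → E) (hX : ∀ i, Measurable (X i))
    (hindep : ProbabilityTheory.iIndepFun X P)
    (hlaw : ∀ i, P.map (X i) = μ)
    (ψ : (Fin p → E) → ℝ) (φ : (Fin q → E) → ℝ)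
    (hψ_meas : Measurable ψ) (hφ_meas : Measurable φ)
    (hψ_symm : UStat.IsSymmetric ψ) (hφ_symm : UStat.IsSymmetric φ)
    (hψ_L2 : MeasureTheory.MemLp ψ 2 (MeasureTheory.Measure.pi (fun _ : Fin p => μ)))
    (hφ_L2 : MeasureTheory.MemLp φ 2 (MeasureTheory.Measure.pi (fun _ : Fin q => μ)))
    (hψ_deg : UStat.IsDegenerate μ ψ) (hφ_deg : UStat.IsDegenerate μ φ) :
    -- each kernel `χ_{p+q-t}` is a measurable, symmetric, degenerate kernel
    (∀ t : Fin (2 * min p q + 1),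
      Measurable
        (UStat.productKernel n μ ψ φ t.1 (m := p + q - t.1) (by omega)) ∧
      UStat.IsSymmetric
        (UStat.productKernel n μ ψ φ t.1 (m := p + q - t.1) (by omega)) ∧
      UStat.IsDegenerate μ
        (UStat.productKernel n μ ψ φ t.1 (m := p + q - t.1) (by omega))) ∧
    -- the product formula
    (∀ᵐ ω ∂P, UStat.uStat X ψ ω * UStat.uStat X φ ω =
      ∑ t : Fin (2 * min p q + 1),
        UStat.uStat X
          (UStat.productKernel n μ ψ φ t.1 (m := p + q - t.1) (by omega)) ω) ∧
    -- it is the Hoeffding decomposition: the summand of a subset `M` of the sample with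
    -- `|M| = p + q - t` is `χ_{p+q-t} (X_j, j ∈ M)`, and the other summands vanish
    UStat.IsHoeffdingDecomposition P X
      (fun ω => UStat.uStat X ψ ω * UStat.uStat X φ ω)
      (fun M ω =>
        if h : p + q - 2 * min p q ≤ M.card ∧ M.card ≤ p + q then
          UStat.productKernel n μ ψ φ (p + q - M.card) (m := M.card) (by omega)
            (fun i => X (M.orderEmbOfFin rfl i) ω)
        else 0) := by
  have hmap : MeasureTheory.MeasurePreserving (fun ω i => X i ω) P
      (MeasureTheory.Measure.pi fun _ : Fin n => μ) := by
    refine ⟨measurable_pi_lambda _ hX, ?_⟩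
    rw [(ProbabilityTheory.iIndepFun_iff_map_fun_eq_pi_map fun i => (hX i).aemeasurable).1 hindep]
    simp only [hlaw]
  have hdec := UStat.isHoeffdingDecomposition_productPart hX hmap hψ_meas hφ_meas hψ_symm hφ_symm
    hψ_L2 hφ_L2 hψ_deg hφ_deg hn
  refine ⟨fun t => ⟨UStat.measurable_productKernel hψ_meas hφ_meas n _,
    UStat.isSymmetric_productKernel hψ_meas hφ_meas n _,
    UStat.isDegenerate_productKernel hψ_meas hφ_meas hψ_L2 hφ_L2 n _⟩, ?_,
    Eq.mp (congrArg _ (funext₂ fun M ω => ?_)) hdec⟩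
  · filter_upwards [hdec.eq_sum] with ω hω
    exact hω.trans (UStat.sum_uSum_productKernel _ fun i => X i ω).symm
  -- The two cardinality conditions on `M` are equivalent under truncated subtraction.
  · exact dite_congr (propext (by omega)) (fun _ => rfl) fun _ => rfl
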